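/- Let $C\subset\mathbb{CP}^2$ be an algebraic curve, smooth or singular, given as the zero set of a squarefree homogeneous polynomial $F\in\mathbb{C}[z_0,z_1,z_2]$ of degree $k\ge 1$. Let $C_{\mathrm{sing}}$ be the set of points of $C$ where the gradient of $F$ vanishes, and let $C_{\mathrm{reg}}=C\setminus C_{\mathrm{sing}}$ (so $C_{\mathrm{reg}}=C$ if $C$ is smooth). Let $(a_d)_{d\in\mathbb{N}}$ be a sequence of positive integers. There is a compact set $K\subset C_{\mathrm{reg}}$ with the following property. For every neighbourhood $\mathcal{U}$ of the inclusion $C_{\mathrm{reg}}\hookrightarrow\mathbb{CP}^2$ in the $\mathscr{C}^\infty$-topology (uniform convergence of all derivatives, in local coordinates, on compact sets) on smooth maps $C_{\mathrm{reg}}\to\mathbb{CP}^2$, there is a smooth embedding $\eta\in\mathcal{U}$ which equals the inclusion outside $K$, whose image is disjoint from $C_{\mathrm{sing}}$ and is symplectic for the Fubini–Study form, and there are smooth algebraic curves $Z_d\subset\mathbb{CP}^2$ of degree $d$, for all $d\ge1$, such that, with $C_\epsilon:=\eta(C_{\mathrm{reg}})\cup C_{\mathrm{sing}}$: 1. for every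 $d\ge 1$ the curve $Z_d$ does not meet $C_{\mathrm{sing}}$ and is transverse to the surface $\eta(C_{\mathrm{reg}})$; 2. $\#(Z_d\cap C_\epsilon)\ge a_d$ for infinitely many $d$. In particular, if $C$ is smooth, then for every $\epsilon>0$ there are a smooth symplectic surface $C_\epsilon=\eta(C)$ that is $\epsilon$-close to $C$ in the $\mathscr{C}^\infty$-topology, and smooth algebraic curves $Z_d$ of degree $d$, all transverse to $C_\epsilon$, with $\#(Z_d\cap C_\epsilon)\ge a_d$ for infinitely many $d$. -/

import Mathlib

open Set Filter Topology
open scoped LinearAlgebra.Projectivization ContDiff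

noncomputable section

/-- The complex projective plane. -/
abbrev CP2 : Type := ℙ ℂ (Fin 3 → ℂ)

/-- The usual topology: the quotient topology from `ℂ³ ∖ {0}`. -/
instance CP2.instTopologicalSpace : TopologicalSpace CP2 :=
  TopologicalSpace.coinduced (Projectivization.mk' (V := Fin 3 → ℂ) ℂ) inferInstance

namespace CP2

/-- The standard affine open set `U_a = {[z] : z_a ≠ 0}`. -/
def affineOpen (a : Fin 3) : Set CP2 := {p | p.rep a ≠ 0}

/-- The standard affine chart on `U_a`. The affine coordinates of `[z]` are `z_j / z_a`; we keep
the constant coordinate `z_a / z_a = 1`, so that the chart takes its values in the affine plane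
`{w ∈ ℂ³ : w_a = 1}`, whose tangent space at any point is `{v ∈ ℂ³ : v_a = 0}`. -/
def chart (a : Fin 3) (p : CP2) : Fin 3 → ℂ := (p.rep a)⁻¹ • p.rep

/-- `f` is (real) smooth at `x`, read in the affine charts. -/
def SmoothAt {E : Type*} [NormedAddCommGroup E] [NormedSpace ℝ E] (f : E → CP2) (x : E) : Prop :=
  ∀ a, f x ∈ affineOpen a → ContDiffAt ℝ ∞ (fun y => chart a (f y)) x

/-- The differential of `f` at `x`, read in the affine charts, is injective. -/
def ImmersiveAt {E : Type*} [NormedAddCommGroup E] [NormedSpace ℝ E] (f : E → CP2) (x : E) :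
    Prop :=
  ∀ a, f x ∈ affineOpen a → Function.Injective (fderiv ℝ (fun y => chart a (f y)) x)

/-! ### Surfaces and smooth maps -/

/-- A smooth local parametrization of a subset `S` of `CP²`: a homeomorphism from an open subset
of `ℂ = ℝ²` onto an open subset of `S` which is a smooth immersion into `CP²`. If `S` is an
embedded smooth surface, these are exactly the inverses of the charts of its maximal atlas. -/
structure LocalParam (S : Set CP2) extends OpenPartialHomeomorph ℂ S where
  smooth : ∀ x ∈ source, SmoothAt (fun z => (toFun z : CP2)) x
  immersive : ∀ x ∈ source, ImmersiveAt (fun z => (toFun z : CP2)) x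

/-- Smooth maps from an embedded smooth surface `S ⊆ CP²` to `CP²`. -/
structure SmoothMap (S : Set CP2) where
  toFun : S → CP2
  smooth : ∀ γ : LocalParam S, ∀ x ∈ γ.source, SmoothAt (fun z => toFun (γ.toFun z)) x

/-- The inclusion `S ↪ CP²`. -/
def SmoothMap.incl (S : Set CP2) : SmoothMap S where
  toFun := Subtype.val
  smooth γ := γ.smooth

/-- A subbasic neighbourhood of `f` in the `C^∞` topology: all `g` such that, in the coordinates
given by the parametrization `γ` of the source and the affine chart `a` of the target, the
derivatives of order at most `r` of `g` differ by less than `ε` from those of `f` on the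
compact set `K`. -/
def SmoothMap.subbasic {S : Set CP2} (f : SmoothMap S) (γ : LocalParam S) (a : Fin 3)
    (K : Set ℂ) (r : ℕ) (ε : ℝ) : Set (SmoothMap S) :=
  {g | ∀ x ∈ K, g.toFun (γ.toFun x) ∈ affineOpen a ∧ ∀ j ≤ r,
    ‖iteratedFDeriv ℝ j (fun z => chart a (g.toFun (γ.toFun z))) x -
      iteratedFDeriv ℝ j (fun z => chart a (f.toFun (γ.toFun z))) x‖ < ε}

/-- The `C^∞` topology on the space of smooth maps from `S` to `CP²`: uniform convergence of all
derivatives on compact subsets of coordinate domains. -/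
instance SmoothMap.instTopologicalSpace (S : Set CP2) : TopologicalSpace (SmoothMap S) :=
  TopologicalSpace.generateFrom
    {N | ∃ (f : SmoothMap S) (γ : LocalParam S) (a : Fin 3) (K : Set ℂ) (r : ℕ) (ε : ℝ),
      IsCompact K ∧ K ⊆ γ.source ∧ (∀ x ∈ K, f.toFun (γ.toFun x) ∈ affineOpen a) ∧ 0 < ε ∧
      N = f.subbasic γ a K r ε}

/-- Smooth embeddings: immersions which are homeomorphisms onto their image. -/
def SmoothMap.IsSmoothEmbedding {S : Set CP2} (f : SmoothMap S) : Prop :=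
  IsEmbedding f.toFun ∧
    ∀ γ : LocalParam S, ∀ x ∈ γ.source, ImmersiveAt (fun z => f.toFun (γ.toFun z)) x

/-! ### Tangent vectors, transversality, the Fubini–Study form -/

/-- The tangent vectors to `S` at `q`, read in the affine chart `a` (for `q ∈ U_a`): velocities
at time `0` of the smooth curves in `S` that pass through `q` at time `0`. -/
def tangentVectors (S : Set CP2) (a : Fin 3) (q : CP2) : Set (Fin 3 → ℂ) :=
  {v | ∃ c : ℝ → CP2, (∀ᶠ t in 𝓝 0, c t ∈ S) ∧ c 0 = q ∧ SmoothAt c 0 ∧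
    HasDerivAt (fun t => chart a (c t)) v 0}

/-- `A` and `B` meet transversally: at every common point the tangent spaces of `A` and `B`
together span the tangent space of `CP²`. -/
def Transverse (A B : Set CP2) : Prop :=
  ∀ q ∈ A ∩ B, ∀ a, q ∈ affineOpen a → ∀ v : Fin 3 → ℂ, v a = 0 →
    ∃ u ∈ tangentVectors A a q, ∃ w ∈ tangentVectors B a q, u + w = v

/-- The Fubini–Study form `(i/2) ∂∂̄ log |z|²` on `ℂ³ ∖ {0}`, evaluated at `z` on `u, w`. It is
the pullback of the Fubini–Study form of `CP²`. -/
def fubiniStudy (z u w : Fin 3 → ℂ) : ℝ :=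
  -(((z ⬝ᵥ star z) * (u ⬝ᵥ star w) - (u ⬝ᵥ star z) * (z ⬝ᵥ star w)) / (z ⬝ᵥ star z) ^ 2).im

/-- `S` is symplectic: the Fubini–Study form is nondegenerate on its tangent spaces. -/
def IsSymplectic (S : Set CP2) : Prop :=
  ∀ q ∈ S, ∀ a, q ∈ affineOpen a → ∀ u ∈ tangentVectors S a q, u ≠ 0 →
    ∃ w ∈ tangentVectors S a q, fubiniStudy (chart a q) u w ≠ 0

/-! ### Algebraic curves -/

/-- The zero locus in `CP²` of a homogeneous polynomial. -/
def zeroLocus (F : MvPolynomial (Fin 3) ℂ) : Set CP2 := {p | MvPolynomial.eval p.rep F = 0}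

/-- The zeros of the homogeneous polynomial `F` at which the gradient of `F` vanishes. -/
def singLocus (F : MvPolynomial (Fin 3) ℂ) : Set CP2 :=
  {p ∈ zeroLocus F | ∀ i, MvPolynomial.eval p.rep (MvPolynomial.pderiv i F) = 0}

/-- The smooth points of the curve `F = 0`. -/
def regLocus (F : MvPolynomial (Fin 3) ℂ) : Set CP2 := zeroLocus F \ singLocus F

/-- `Z` is a smooth algebraic curve of degree `d`. -/
def IsSmoothCurve (Z : Set CP2) (d : ℕ) : Prop :=
  ∃ G : MvPolynomial (Fin 3) ℂ, G.IsHomogeneous d ∧ singLocus G = ∅ ∧ Z = zeroLocus G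

end CP2

end

/-! A holomorphic perturbation could not work, since Bezout bounds the intersections of two
algebraic curves; a smooth one can oscillate. Fix a regular point `q` of `C`. Near it, in an affine
chart `z_a = 1`, the curve is a graph over the coordinate `z_b`, with `∂F/∂z_c ≠ 0`. Push the curve
in the direction `z_c` by `t χ u(z_b - q_b)`, where `χ` is a bump function and `u` is a smooth
function with infinitely many nondegenerate zeros accumulating at `0`
(`exists_smooth_accumulating_zeros`). Whatever the value of `t ≠ 0`, the pushed surface meets `F =
0` nondegenerately at infinitely many points (`exists_perturbation`).

The push is the restriction of a self-map of `CP²` induced by `z ↦ z + t P z`, with `P` homogeneous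
of degree one and smooth away from `0`. Such a `P` is Lipschitz, so for small `t` the map is an
injective immersion of a compact Hausdorff space, hence an embedding. It tends to the inclusion as
`t → 0` (`tendsto_smoothMap`), and compactness keeps the image of the complex curve symplectic
(`eventually_isSymplectic`). The support of `P`, up to scaling, lies in a compact set of points of
nonzero gradient. This yields a `K` that does not depend on `𝒰`, and the singular points stay fixed.

For `d ≥ k` the form `G₀ = F z_a^(d-k)` of degree `d` has infinitely many nondegenerate zeros on the
pushed surface. Any `a d` of them survive a small change of coefficients (`eventually_le_encard`).
Within the family `G₀ + ∑ θ_ij z_i^(d-1) z_j`, almost every `θ` gives a smooth curve that is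
transverse to the surface and misses the countable set of singular points. The null sets come from
the equidimensional case of Sard's theorem (`addHaar_image_eq_zero_of_ker`). A generic `θ` close to
`0` therefore has all the required properties; in degrees `d < k` any generic member will do. -/

noncomputable section

namespace CP2

/-! ### Homogeneous coordinates -/

/-- The class of `z` in the projective plane, with a junk value at `z = 0`. -/
def proj (z : Fin 3 → ℂ) : CP2 :=
  if h : z ≠ 0 then Projectivization.mk ℂ z h
  else Projectivization.mk ℂ (fun _ => 1) (fun h => one_ne_zero (congrFun h 0))

theorem proj_of_ne {z : Fin 3 → ℂ} (h : z ≠ 0) : proj z = Projectivization.mk ℂ z h := dif_pos h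

theorem proj_rep (p : CP2) : proj p.rep = p := by
  rw [proj_of_ne p.rep_nonzero, Projectivization.mk_rep]

theorem proj_eq_proj_iff {z w : Fin 3 → ℂ} (hz : z ≠ 0) (hw : w ≠ 0) :
    proj z = proj w ↔ ∃ c : ℂ, c ≠ 0 ∧ z = c • w := by
  rw [proj_of_ne hz, proj_of_ne hw, Projectivization.mk_eq_mk_iff']
  constructor
  · rintro ⟨c, rfl⟩
    exact ⟨c, fun h => hz (by simp [h]), rfl⟩
  · rintro ⟨c, -, rfl⟩
    exact ⟨c, rfl⟩

theorem proj_smul {z : Fin 3 → ℂ} (hz : z ≠ 0) {c : ℂ} (hc : c ≠ 0) : proj (c • z) = proj z :=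
  (proj_eq_proj_iff (smul_ne_zero hc hz) hz).2 ⟨c, hc, rfl⟩

theorem exists_rep_proj {z : Fin 3 → ℂ} (hz : z ≠ 0) : ∃ c : ℂ, c ≠ 0 ∧ (proj z).rep = c • z :=
  (proj_eq_proj_iff (proj z).rep_nonzero hz).1 (proj_rep _)

theorem proj_mem_affineOpen {z : Fin 3 → ℂ} (hz : z ≠ 0) {a : Fin 3} :
    proj z ∈ affineOpen a ↔ z a ≠ 0 := by
  obtain ⟨c, hc, h⟩ := exists_rep_proj hz
  simp [affineOpen, h, hc]

theorem chart_proj {z : Fin 3 → ℂ} (hz : z ≠ 0) (a : Fin 3) :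
    chart a (proj z) = (z a)⁻¹ • z := by
  obtain ⟨c, hc, h⟩ := exists_rep_proj hz
  ext i
  simp only [chart, h, Pi.smul_apply, smul_eq_mul, mul_inv]
  field_simp

theorem chart_self {p : CP2} {a : Fin 3} (hp : p ∈ affineOpen a) : chart a p a = 1 := by
  simpa [chart] using inv_mul_cancel₀ hp

theorem chart_ne_zero {p : CP2} {a : Fin 3} (hp : p ∈ affineOpen a) : chart a p ≠ 0 := fun h => by
  simpa [h] using chart_self hp

theorem proj_chart {p : CP2} {a : Fin 3} (hp : p ∈ affineOpen a) : proj (chart a p) = p := by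
  rw [chart, proj_smul p.rep_nonzero (inv_ne_zero hp), proj_rep]

theorem exists_mem_affineOpen (p : CP2) : ∃ a, p ∈ affineOpen a := by
  by_contra! h
  exact p.rep_nonzero (funext fun a => not_not.1 (h a))

theorem continuousAt_proj {z : Fin 3 → ℂ} (hz : z ≠ 0) : ContinuousAt proj z := by
  have h1 : Continuous (Projectivization.mk' (V := Fin 3 → ℂ) ℂ) := continuous_coinduced_rng
  have h2 : ContinuousOn proj {0}ᶜ := by
    rw [continuousOn_iff_continuous_domRestrict]
    have : Set.domRestrict {0}ᶜ proj = Projectivization.mk' (V := Fin 3 → ℂ) ℂ :=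
      funext fun z => proj_of_ne z.2
    exact this ▸ h1
  exact h2.continuousAt (isOpen_compl_singleton.mem_nhds hz)

theorem continuous_iff_proj {X : Type*} [TopologicalSpace X] {f : CP2 → X} :
    Continuous f ↔ ContinuousOn (fun z => f (proj z)) {0}ᶜ := by
  rw [continuous_coinduced_dom, continuousOn_iff_continuous_domRestrict]
  have : Set.domRestrict {0}ᶜ (fun z => f (proj z)) =
      f ∘ Projectivization.mk' (V := Fin 3 → ℂ) ℂ :=
    funext fun z => congrArg f (proj_of_ne z.2)
  exact this ▸ Iff.rfl

instance instCompactSpace : CompactSpace CP2 := by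
  have h : (Set.univ : Set CP2) = proj '' Metric.sphere 0 1 := by
    refine (eq_univ_of_forall fun p => ?_).symm
    have hp := norm_ne_zero_iff.2 p.rep_nonzero
    refine ⟨((‖p.rep‖⁻¹ : ℝ) : ℂ) • p.rep, ?_, ?_⟩
    · simp [norm_smul, hp]
    · rw [proj_smul p.rep_nonzero (by simpa using hp), proj_rep]
  refine ⟨h ▸ (isCompact_sphere _ _).image_of_continuousOn fun z hz => ?_⟩
  exact (continuousAt_proj (ne_zero_of_mem_sphere one_ne_zero ⟨z, hz⟩)).continuousWithinAt

/-- The matrix is the orthogonal projector onto the line `p`. It determines `p`, which is how `CP²`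
is seen to be Hausdorff. -/
theorem continuous_rankOne : Continuous fun (p : CP2) (i j : Fin 3) =>
    p.rep i * star (p.rep j) / ∑ l, ((‖p.rep l‖ ^ 2 : ℝ) : ℂ) := by
  rw [continuous_iff_proj]
  have key : ∀ z ∈ ({0}ᶜ : Set (Fin 3 → ℂ)), (fun i j : Fin 3 => (proj z).rep i *
      star ((proj z).rep j) / ∑ l, ((‖(proj z).rep l‖ ^ 2 : ℝ) : ℂ)) =
      fun i j => z i * star (z j) / ∑ l, ((‖z l‖ ^ 2 : ℝ) : ℂ) := by
    intro z hz
    obtain ⟨c, hc, h⟩ := exists_rep_proj hz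
    ext i j
    have h2 : ((‖c‖ ^ 2 : ℝ) : ℂ) = c * star c := by
      simpa using (Complex.mul_conj' c).symm
    have h3 : ((‖c‖ ^ 2 : ℝ) : ℂ) ≠ 0 := by simpa using hc
    rw [h]
    simp only [Pi.smul_apply, smul_eq_mul, norm_mul, mul_pow, Complex.ofReal_mul, star_mul']
    rw [← Finset.mul_sum, mul_mul_mul_comm, ← h2, mul_div_mul_left _ _ h3]
  refine ContinuousOn.congr ?_ key
  refine continuousOn_pi.2 fun i => continuousOn_pi.2 fun j => ContinuousOn.div ?_ ?_ ?_
  · fun_prop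
  · fun_prop
  · intro z hz h
    rw [← Complex.ofReal_sum, Complex.ofReal_eq_zero,
      Finset.sum_eq_zero_iff_of_nonneg (fun _ _ => by positivity)] at h
    exact hz (funext fun l => by simpa using h l (Finset.mem_univ l))

instance instT2Space : T2Space CP2 := by
  refine T2Space.of_injective_continuous (fun p q h => ?_) continuous_rankOne
  obtain ⟨j, hj⟩ := exists_mem_affineOpen q
  have hN : ∀ p : CP2, (∑ l, ((‖p.rep l‖ ^ 2 : ℝ) : ℂ)) ≠ 0 := by
    intro p h
    rw [← Complex.ofReal_sum, Complex.ofReal_eq_zero,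
      Finset.sum_eq_zero_iff_of_nonneg (fun _ _ => by positivity)] at h
    exact p.rep_nonzero (funext fun l => by simpa using h l (Finset.mem_univ l))
  have h' := fun i j => congrFun (congrFun h i) j
  have hpj : star (p.rep j) ≠ 0 := by
    intro h0
    have := h' j j
    rw [h0] at this
    have h1 : q.rep j * star (q.rep j) / ∑ l, ((‖q.rep l‖ ^ 2 : ℝ) : ℂ) = 0 := by
      rw [← this]; simp
    have hj' : q.rep j ≠ 0 := hj
    rw [div_eq_zero_iff, mul_eq_zero, star_eq_zero] at h1
    tauto
  rw [← proj_rep p, ← proj_rep q, proj_eq_proj_iff p.rep_nonzero q.rep_nonzero]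
  have hj' : star (q.rep j) ≠ 0 := star_ne_zero.2 hj
  refine ⟨star (q.rep j) / (∑ l, ((‖q.rep l‖ ^ 2 : ℝ) : ℂ)) *
    (∑ l, ((‖p.rep l‖ ^ 2 : ℝ) : ℂ)) / star (p.rep j), ?_, ?_⟩
  · exact div_ne_zero (mul_ne_zero (div_ne_zero hj' (hN q)) (hN p)) hpj
  · ext i
    have := h' i j
    rw [div_eq_div_iff (hN p) (hN q)] at this
    rw [Pi.smul_apply, smul_eq_mul, div_mul_eq_mul_div, eq_div_iff hpj, div_mul_eq_mul_div,
      div_mul_eq_mul_div, eq_div_iff (hN q)]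
    linear_combination this

/-! ### Smoothness, immersions and tangent vectors in homogeneous coordinates -/

section Lifts

variable {E : Type*} [NormedAddCommGroup E] [NormedSpace ℝ E]

/-- The derivative of `z ↦ (z a)⁻¹ • z`. -/
def normDeriv (a : Fin 3) (z v : Fin 3 → ℂ) : Fin 3 → ℂ :=
  (z a)⁻¹ • v - (((z a)⁻¹) ^ 2 * v a) • z

theorem SmoothAt.eventually_mem {f : E → CP2} {x : E} (hf : SmoothAt f x) {a : Fin 3}
    (ha : f x ∈ affineOpen a) : ∀ᶠ y in 𝓝 x, f y ∈ affineOpen a := by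
  have h1 : ContinuousAt (fun y => chart a (f y) a) x :=
    ((continuous_apply a).continuousAt).comp (hf a ha).continuousAt
  have h2 : chart a (f x) a ≠ 0 := by rw [chart_self ha]; exact one_ne_zero
  filter_upwards [h1.eventually_ne h2] with y hy h
  exact hy (by simp [chart, h])

theorem SmoothAt.eventually_proj_chart {f : E → CP2} {x : E} (hf : SmoothAt f x) {a : Fin 3}
    (ha : f x ∈ affineOpen a) : f =ᶠ[𝓝 x] fun y => proj (chart a (f y)) := by
  filter_upwards [hf.eventually_mem ha] with y hy
  exact (proj_chart hy).symm

theorem contDiffAt_normalize {z : E → Fin 3 → ℂ} {x : E} {a : Fin 3}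
    (hz : ContDiffAt ℝ ∞ z x) (ha : z x a ≠ 0) :
    ContDiffAt ℝ ∞ (fun y => (z y a)⁻¹ • z y) x := by
  have h1 : ContDiffAt ℝ ∞ (fun y => z y a) x := contDiffAt_pi.1 hz a
  exact (h1.inv ha).smul hz

theorem hasFDerivAt_normalize {z : E → Fin 3 → ℂ} {x : E} {a : Fin 3}
    {z' : E →L[ℝ] Fin 3 → ℂ} (hz : HasFDerivAt z z' x) (ha : z x a ≠ 0) (v : E) :
    DifferentiableAt ℝ (fun y => (z y a)⁻¹ • z y) x ∧
    fderiv ℝ (fun y => (z y a)⁻¹ • z y) x v = normDeriv a (z x) (z' v) := by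
  have h1 : HasFDerivAt (fun y => z y a) ((ContinuousLinearMap.proj a).comp z') x :=
    (hasFDerivAt_pi'.1 hz) a
  have h2 : HasFDerivAt (fun y => (z y a)⁻¹) _ x := (hasFDerivAt_inv' (𝕜 := ℝ) ha).comp x h1
  have h3 := h2.smul hz
  refine ⟨h3.differentiableAt, ?_⟩
  erw [h3.fderiv]
  ext i
  simp [normDeriv]
  ring

/-- Together with `SmoothAt.exists_lift`, this replaces the affine charts by smooth nonvanishing
lifts to `ℂ³`, where the maps `z ↦ z + t P z` have a simple form. -/
theorem smoothAt_of_lift {f : E → CP2} {z : E → Fin 3 → ℂ} {x : E} (hz : ContDiffAt ℝ ∞ z x)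
    (h0 : z x ≠ 0) (hf : f =ᶠ[𝓝 x] fun y => proj (z y)) : SmoothAt f x := by
  intro a ha
  rw [hf.eq_of_nhds, proj_mem_affineOpen h0] at ha
  refine (contDiffAt_normalize hz ha).congr_of_eventuallyEq ?_
  filter_upwards [hf, hz.continuousAt.eventually_ne h0] with y h1 h2
  rw [h1, chart_proj h2]

theorem SmoothAt.exists_lift {f : E → CP2} {x : E} (hf : SmoothAt f x) :
    ∃ z : E → Fin 3 → ℂ, ContDiffAt ℝ ∞ z x ∧ z x ≠ 0 ∧ f =ᶠ[𝓝 x] fun y => proj (z y) := by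
  obtain ⟨a, ha⟩ := exists_mem_affineOpen (f x)
  exact ⟨_, hf a ha, chart_ne_zero ha, hf.eventually_proj_chart ha⟩

theorem normDeriv_eq_zero_iff {a : Fin 3} {z v : Fin 3 → ℂ} (ha : z a ≠ 0) :
    normDeriv a z v = 0 ↔ ∃ c : ℂ, v = c • z := by
  constructor
  · intro h
    refine ⟨(z a)⁻¹ * v a, ?_⟩
    rw [normDeriv, sub_eq_zero] at h
    have := congrArg (fun w => z a • w) h
    simp only [smul_smul, mul_inv_cancel₀ ha, one_smul] at this
    refine this.trans ?_
    congr 1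
    field_simp
  · rintro ⟨c, rfl⟩
    ext i
    simp only [normDeriv, Pi.sub_apply, Pi.smul_apply, smul_eq_mul, Pi.zero_apply]
    field_simp
    ring

/-- The derivative of the normalization `z ↦ (z a)⁻¹ • z` has kernel exactly the complex line
spanned by `z`. -/
theorem immersiveAt_iff_of_lift {f : E → CP2} {z : E → Fin 3 → ℂ} {x : E}
    (hz : ContDiffAt ℝ ∞ z x) (h0 : z x ≠ 0) (hf : f =ᶠ[𝓝 x] fun y => proj (z y)) :
    ImmersiveAt f x ↔ ∀ (v : E) (c : ℂ), fderiv ℝ z x v = c • z x → v = 0 := by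
  have hz' := (hz.differentiableAt (by simp)).hasFDerivAt
  have key : ∀ a, f x ∈ affineOpen a → ∀ v : E,
      fderiv ℝ (fun y => chart a (f y)) x v = normDeriv a (z x) (fderiv ℝ z x v) := by
    intro a ha v
    rw [hf.eq_of_nhds, proj_mem_affineOpen h0] at ha
    rw [← (hasFDerivAt_normalize hz' ha v).2]
    have : (fun y => chart a (f y)) =ᶠ[𝓝 x] fun y => (z y a)⁻¹ • z y := by
      filter_upwards [hf, hz.continuousAt.eventually_ne h0] with y h1 h2
      rw [h1, chart_proj h2]
    rw [this.fderiv_eq]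
  constructor
  · intro h v c hv
    obtain ⟨a, ha⟩ := exists_mem_affineOpen (f x)
    have ha' := ha
    rw [hf.eq_of_nhds, proj_mem_affineOpen h0] at ha'
    refine (injective_iff_map_eq_zero _).1 (h a ha) v ?_
    rw [key a ha, normDeriv_eq_zero_iff ha']
    exact ⟨c, hv⟩
  · intro h a ha
    have ha' := ha
    rw [hf.eq_of_nhds, proj_mem_affineOpen h0] at ha'
    refine (injective_iff_map_eq_zero _).2 fun v hv => ?_
    rw [key a ha, normDeriv_eq_zero_iff ha'] at hv
    obtain ⟨c, hc⟩ := hv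
    exact h v c hc

end Lifts

theorem normDeriv_mem_tangentVectors {S : Set CP2} {z : ℝ → Fin 3 → ℂ} {v : Fin 3 → ℂ}
    {a : Fin 3} (hz : ContDiffAt ℝ ∞ z 0) (ha : z 0 a ≠ 0) (hv : HasDerivAt z v 0)
    (hS : ∀ᶠ t in 𝓝 0, proj (z t) ∈ S) :
    normDeriv a (z 0) v ∈ tangentVectors S a (proj (z 0)) := by
  have h0 : z 0 ≠ 0 := fun h => ha (by simp [h])
  refine ⟨fun t => proj (z t), hS, rfl, smoothAt_of_lift hz h0 .rfl, ?_⟩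
  obtain ⟨h1, h2⟩ := hasFDerivAt_normalize hv.hasFDerivAt ha 1
  have h3 : HasDerivAt (fun y => (z y a)⁻¹ • z y) (normDeriv a (z 0) v) 0 := by
    have := h1.hasFDerivAt.hasDerivAt
    rw [h2] at this
    simpa using this
  refine h3.congr_of_eventuallyEq ?_
  filter_upwards [hz.continuousAt.eventually_ne h0] with y h2
  rw [chart_proj h2]

theorem exists_lift_of_mem_tangentVectors {S : Set CP2} {q : CP2} {a : Fin 3} {v : Fin 3 → ℂ}
    (hq : q ∈ affineOpen a) (hv : v ∈ tangentVectors S a q) :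
    v a = 0 ∧ ∃ z : ℝ → Fin 3 → ℂ, ContDiffAt ℝ ∞ z 0 ∧ z 0 = chart a q ∧ HasDerivAt z v 0 ∧
      ∀ᶠ t in 𝓝 0, z t ≠ 0 ∧ proj (z t) ∈ S := by
  obtain ⟨c, hS, rfl, hc, hd⟩ := hv
  refine ⟨?_, _, hc a hq, rfl, hd, ?_⟩
  · have h1 : HasDerivAt (fun t => chart a (c t) a) (v a) 0 := (hasDerivAt_pi.1 hd) a
    refine h1.unique ((hasDerivAt_const (0 : ℝ) (1 : ℂ)).congr_of_eventuallyEq ?_)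
    filter_upwards [hc.eventually_mem hq] with t ht
    exact chart_self ht
  · filter_upwards [hS, hc.eventually_mem hq] with t h1 h2
    exact ⟨chart_ne_zero h2, by rwa [proj_chart h2]⟩

end CP2

namespace CP2

open MvPolynomial

/-! ### Polynomials as functions on `ℂ³` -/

/-- The differential of the polynomial function `G` at `z`. -/
def evalDeriv (G : MvPolynomial (Fin 3) ℂ) (z : Fin 3 → ℂ) : (Fin 3 → ℂ) →L[ℂ] ℂ :=
  ∑ i, eval z (pderiv i G) • ContinuousLinearMap.proj i

theorem evalDeriv_apply (G : MvPolynomial (Fin 3) ℂ) (z v : Fin 3 → ℂ) :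
    evalDeriv G z v = ∑ i, eval z (pderiv i G) * v i := by
  simp [evalDeriv]

theorem evalDeriv_single (G : MvPolynomial (Fin 3) ℂ) (z : Fin 3 → ℂ) (c : Fin 3) (w : ℂ) :
    evalDeriv G z (Pi.single c w) = eval z (pderiv c G) * w := by
  rw [evalDeriv_apply, Finset.sum_eq_single c]
  · simp
  · intro i _ hi
    simp [Pi.single_eq_of_ne hi]
  · simp

theorem hasFDerivAt_eval (G : MvPolynomial (Fin 3) ℂ) (z : Fin 3 → ℂ) :
    HasFDerivAt (𝕜 := ℂ) (fun z => eval z G) (evalDeriv G z) z := by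
  induction G using MvPolynomial.induction_on with
  | C a =>
    have : evalDeriv (C a) z = 0 := by ext v; simp [evalDeriv_apply]
    simpa [this] using hasFDerivAt_const a z
  | add p q hp hq =>
    have : evalDeriv (p + q) z = evalDeriv p z + evalDeriv q z := by
      ext v; simp [evalDeriv_apply, add_mul, Finset.sum_add_distrib]
    simp only [this, map_add]
    exact hp.add hq
  | mul_X p n hp =>
    have h := hp.mul (ContinuousLinearMap.proj (R := ℂ) (φ := fun _ : Fin 3 => ℂ) n).hasFDerivAt
    have : evalDeriv (p * X n) z = eval z p • ContinuousLinearMap.proj n + z n • evalDeriv p z := by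
      ext v
      simp only [evalDeriv_apply, Derivation.leibniz, pderiv_X, smul_eq_mul, map_add, map_mul,
        eval_X, add_mul, Finset.sum_add_distrib, _root_.add_apply,
        _root_.smul_apply, ContinuousLinearMap.proj_apply, Finset.mul_sum]
      congr 1
      · rw [Finset.sum_eq_single n]
        · simp
        · intro i _ hi
          simp [Pi.single_eq_of_ne' hi]
        · simp
      · exact Finset.sum_congr rfl fun i _ => by ring
    simp only [this, map_mul, eval_X]
    exact h

theorem contDiff_eval (G : MvPolynomial (Fin 3) ℂ) : ContDiff ℂ ω fun z => eval z G :=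
  (AnalyticOnNhd.eval_mvPolynomial G).contDiff

theorem contDiff_real_eval (G : MvPolynomial (Fin 3) ℂ) : ContDiff ℝ ∞ fun z => eval z G :=
  ((contDiff_eval G).restrict_scalars ℝ).of_le le_top

theorem hasFDerivAt_real_eval (G : MvPolynomial (Fin 3) ℂ) (z : Fin 3 → ℂ) :
    HasFDerivAt (𝕜 := ℝ) (fun z => eval z G) ((evalDeriv G z).restrictScalars ℝ) z :=
  (hasFDerivAt_eval G z).restrictScalars ℝ

theorem eval_smul_of_isHomogeneous {G : MvPolynomial (Fin 3) ℂ} {d : ℕ} (hG : G.IsHomogeneous d)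
    (c : ℂ) (z : Fin 3 → ℂ) : eval (c • z) G = c ^ d * eval z G := by
  rw [eval_eq', eval_eq', Finset.mul_sum]
  refine Finset.sum_congr rfl fun m hm => ?_
  have h : d = ∑ i, m i := by
    rw [hG.degree_eq_sum_deg_support hm]
    exact Finset.sum_subset (Finset.subset_univ _) fun i _ hi => Finsupp.notMem_support_iff.1 hi
  simp only [Pi.smul_apply, smul_eq_mul, mul_pow, Finset.prod_mul_distrib]
  rw [Finset.prod_pow_eq_pow_sum, ← h]
  ring

theorem proj_mem_zeroLocus {G : MvPolynomial (Fin 3) ℂ} {d : ℕ} (hG : G.IsHomogeneous d)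
    {z : Fin 3 → ℂ} (hz : z ≠ 0) : proj z ∈ zeroLocus G ↔ eval z G = 0 := by
  obtain ⟨c, hc, h⟩ := exists_rep_proj hz
  simp [zeroLocus, h, eval_smul_of_isHomogeneous hG, hc]

theorem proj_mem_singLocus {G : MvPolynomial (Fin 3) ℂ} {d : ℕ} (hG : G.IsHomogeneous d)
    {z : Fin 3 → ℂ} (hz : z ≠ 0) :
    proj z ∈ singLocus G ↔ eval z G = 0 ∧ ∀ i, eval z (pderiv i G) = 0 := by
  obtain ⟨c, hc, h⟩ := exists_rep_proj hz
  have : ∀ i, eval (c • z) (pderiv i G) = 0 ↔ eval z (pderiv i G) = 0 := fun i => by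
    rw [eval_smul_of_isHomogeneous (hG.pderiv (i := i))]; simp [hc]
  rw [singLocus, mem_ofPred_eq, proj_mem_zeroLocus hG hz, h]
  simp only [this]

theorem proj_mem_regLocus {G : MvPolynomial (Fin 3) ℂ} {d : ℕ} (hG : G.IsHomogeneous d)
    {z : Fin 3 → ℂ} (hz : z ≠ 0) :
    proj z ∈ regLocus G ↔ eval z G = 0 ∧ ∃ i, eval z (pderiv i G) ≠ 0 := by
  rw [regLocus, Set.mem_sdiff, proj_mem_zeroLocus hG hz, proj_mem_singLocus hG hz]
  push Not
  tauto

/-! ### The implicit function theorem for the zero set of a polynomial -/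

theorem hasFDerivAt_update_eval (G : MvPolynomial (Fin 3) ℂ) (c : Fin 3) (z : Fin 3 → ℂ) :
    HasFDerivAt (𝕜 := ℂ) (fun z => Function.update z c (eval z G))
      (ContinuousLinearMap.id ℂ _ + (ContinuousLinearMap.single ℂ (fun _ : Fin 3 => ℂ) c).comp
        (evalDeriv G z - ContinuousLinearMap.proj c)) z := by
  have h : (fun z : Fin 3 → ℂ => Function.update z c (eval z G)) =
      fun z => z + ContinuousLinearMap.single ℂ (fun _ : Fin 3 => ℂ) c (eval z G - z c) := by
    ext z i
    by_cases hi : i = c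
    · subst hi; simp
    · simp [hi]
  rw [h]
  exact (hasFDerivAt_id z).add ((ContinuousLinearMap.hasFDerivAt _).comp z
    ((hasFDerivAt_eval G z).sub
      (ContinuousLinearMap.proj (R := ℂ) (φ := fun _ : Fin 3 => ℂ) c).hasFDerivAt))

/-- When `∂G/∂z_c ≠ 0`, replacing the coordinate `z_c` by the value of `G` is a local change of
coordinates; `Ψ` is its inverse. -/
theorem exists_local_straightening {G : MvPolynomial (Fin 3) ℂ} {z₀ : Fin 3 → ℂ} {c : Fin 3}
    (hc : eval z₀ (pderiv c G) ≠ 0) :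
    ∃ Ψ : (Fin 3 → ℂ) → Fin 3 → ℂ,
      ContDiffAt ℝ ω Ψ (Function.update z₀ c (eval z₀ G)) ∧
      Ψ (Function.update z₀ c (eval z₀ G)) = z₀ ∧
      (∀ᶠ y in 𝓝 (Function.update z₀ c (eval z₀ G)),
        Function.update (Ψ y) c (eval (Ψ y) G) = y) ∧
      ∀ᶠ z in 𝓝 z₀, Ψ (Function.update z c (eval z G)) = z := by
  set A : (Fin 3 → ℂ) →L[ℂ] Fin 3 → ℂ := ContinuousLinearMap.id ℂ _ +
    (ContinuousLinearMap.single ℂ (fun _ : Fin 3 => ℂ) c).comp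
      (evalDeriv G z₀ - ContinuousLinearMap.proj c) with hA
  have hinj : Function.Injective (A : (Fin 3 → ℂ) →ₗ[ℂ] Fin 3 → ℂ) := by
    refine (injective_iff_map_eq_zero _).2 fun v hv => ?_
    have h1 : v = Pi.single c (v c) := by
      ext i
      by_cases hi : i = c
      · subst hi; simp
      · have := congrFun hv i
        simpa [hA, hi, Pi.single_eq_of_ne hi] using this
    have h2 : evalDeriv G z₀ v = 0 := by
      have := congrFun hv c
      simpa [hA] using this
    rw [h1, evalDeriv_single] at h2
    rw [h1, (mul_eq_zero.1 h2).resolve_left hc, Pi.single_zero]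
  set e : (Fin 3 → ℂ) ≃L[ℂ] Fin 3 → ℂ :=
    (LinearEquiv.ofInjectiveEndo _ hinj).toContinuousLinearEquiv
  have he : (e : (Fin 3 → ℂ) →L[ℂ] Fin 3 → ℂ) = A := by ext v; rfl
  have hd := hasFDerivAt_update_eval G c z₀
  rw [← hA, ← he] at hd
  have hcd : ContDiffAt ℂ ω (fun z => Function.update z c (eval z G)) z₀ := by
    refine (contDiff_pi.2 fun i => ?_).contDiffAt
    by_cases hi : i = c
    · subst hi; simpa using contDiff_eval G
    · simpa [hi] using contDiff_apply ℂ ℂ i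
  have hs := hcd.hasStrictFDerivAt' hd (by simp)
  exact ⟨hcd.localInverse hd (by simp), (hcd.to_localInverse hd (by simp)).restrict_scalars ℝ,
    hcd.localInverse_apply_image hd (by simp), hs.eventually_right_inverse,
    hs.eventually_left_inverse⟩

/-- In the straightened coordinates the curve is a straight line. Its velocity has `c`-component
`dG(v) = 0`, so it stays where `G = 0`. -/
theorem exists_curve_of_evalDeriv_eq_zero {G : MvPolynomial (Fin 3) ℂ} {z₀ v : Fin 3 → ℂ}
    (h0 : eval z₀ G = 0) (hc : ∃ c, eval z₀ (pderiv c G) ≠ 0) (hv : evalDeriv G z₀ v = 0) :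
    ∃ z : ℝ → Fin 3 → ℂ, ContDiffAt ℝ ∞ z 0 ∧ z 0 = z₀ ∧ HasDerivAt z v 0 ∧
      ∀ᶠ t in 𝓝 0, eval (z t) G = 0 := by
  obtain ⟨c, hc⟩ := hc
  obtain ⟨Ψ, h1, h2, h3, h4⟩ := exists_local_straightening hc
  have hd := (hasFDerivAt_update_eval G c z₀).restrictScalars ℝ
  set A := (ContinuousLinearMap.id ℂ _ +
    (ContinuousLinearMap.single ℂ (fun _ : Fin 3 => ℂ) c).comp
      (evalDeriv G z₀ - ContinuousLinearMap.proj c)).restrictScalars ℝ with hA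
  set y₀ := Function.update z₀ c (eval z₀ G) with hy₀
  have hΨ := (h1.differentiableAt (by simp)).hasFDerivAt
  have hcomp : fderiv ℝ Ψ y₀ (A v) = v := by
    have h5 : HasFDerivAt (fun z => Ψ (Function.update z c (eval z G))) _ z₀ := hΨ.comp z₀ hd
    have h6 := h5.unique ((hasFDerivAt_id z₀).congr_of_eventuallyEq h4)
    exact congrArg (fun L => L v) h6
  have hline : HasDerivAt (fun t : ℝ => y₀ + t • A v) (A v) 0 := by
    simpa using ((hasDerivAt_id (0 : ℝ)).smul_const (A v)).const_add y₀
  have hl0 : y₀ + (0 : ℝ) • A v = y₀ := by simp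
  have hcont : Tendsto (fun t : ℝ => y₀ + t • A v) (𝓝 0) (𝓝 y₀) := by
    have := hline.continuousAt.tendsto
    rwa [hl0] at this
  refine ⟨fun t => Ψ (y₀ + t • A v), ?_, ?_, ?_, ?_⟩
  · refine ContDiffAt.comp (0 : ℝ) (by rw [hl0]; exact h1.of_le le_top) ?_
    exact contDiffAt_const.add (contDiffAt_id.smul contDiffAt_const)
  · simp [h2]
  · have := HasFDerivAt.comp_hasDerivAt (0 : ℝ) (by rwa [hl0]) hline
    rwa [hcomp] at this
  · filter_upwards [hcont.eventually h3] with t ht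
    have := congrFun ht c
    simp only [Function.update_self] at this
    rw [this]
    simp [hy₀, hA, h0, hv]

/-- The coordinate other than `b` and `c` is frozen, so that the cone `G = 0` becomes a graph over
`z_b`. Regularity `ω`, unlike `∞`, passes from a point to a whole neighbourhood, which is needed to
get an open domain of smoothness. -/
theorem exists_local_param {G : MvPolynomial (Fin 3) ℂ} {z₀ : Fin 3 → ℂ} {b c : Fin 3}
    (hbc : b ≠ c) (h0 : eval z₀ G = 0) (hc : eval z₀ (pderiv c G) ≠ 0) :
    ∃ σ : ℂ → Fin 3 → ℂ, ContDiffAt ℝ ω σ (z₀ b) ∧ σ (z₀ b) = z₀ ∧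
      (∀ᶠ x in 𝓝 (z₀ b), eval (σ x) G = 0 ∧ σ x b = x ∧ ∀ i, i ≠ b → i ≠ c → σ x i = z₀ i) ∧
      ∀ᶠ z in 𝓝 z₀, eval z G = 0 → (∀ i, i ≠ b → i ≠ c → z i = z₀ i) → z = σ (z b) := by
  obtain ⟨Ψ, h1, h2, h3, h4⟩ := exists_local_straightening hc
  rw [h0] at h1 h2 h3
  have hl0 : Function.update (Function.update z₀ c 0) b (z₀ b) = Function.update z₀ c 0 := by
    rw [Function.update_eq_self_iff]
    simp [hbc]
  have hcd : ContDiffAt ℝ ω (fun x => Function.update (Function.update z₀ c 0) b x) (z₀ b) := by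
    refine (contDiff_pi.2 fun i => ?_).contDiffAt
    by_cases hi : i = b
    · subst hi; simpa using contDiff_fun_id
    · simpa [hi] using contDiff_const
  have hcont : Tendsto (fun x => Function.update (Function.update z₀ c 0) b x) (𝓝 (z₀ b))
      (𝓝 (Function.update z₀ c 0)) := by
    have := hcd.continuousAt.tendsto
    rwa [hl0] at this
  refine ⟨fun x => Ψ (Function.update (Function.update z₀ c 0) b x), ?_,
    by simpa only [hl0] using h2, ?_, ?_⟩
  · exact ContDiffAt.comp (z₀ b) (by rwa [hl0]) hcd
  · filter_upwards [hcont.eventually h3] with x hx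
    have hx' := fun i => congrFun hx i
    refine ⟨?_, ?_, fun i hib hic => ?_⟩
    · have := hx' c
      simpa [hbc.symm] using this
    · have := hx' b
      simpa [hbc] using this
    · have := hx' i
      simpa [hib, hic] using this
  · filter_upwards [h4] with z hz hG hi
    have : Function.update (Function.update z₀ c 0) b (z b) = Function.update z c (eval z G) := by
      ext i
      by_cases hib : i = b
      · subst hib; simp [hbc]
      · by_cases hic : i = c
        · subst hic; simp [hib, hG]
        · simp [hib, hic, hi i hib hic]
    rw [this, hz]

end CP2

namespace CP2

open MvPolynomial

/-! ### Singular points of a reduced curve -/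

/-- Over a factorial domain of characteristic zero, a squarefree polynomial and its derivative
generate an ideal which contains a nonzero constant. -/
theorem _root_.Squarefree.exists_mul_add_mul_derivative_eq_C {R : Type*} [CommRing R] [IsDomain R]
    [UniqueFactorizationMonoid R] [CharZero R] {f : Polynomial R} (hf : Squarefree f) :
    ∃ (r : R) (u v : Polynomial R), r ≠ 0 ∧
      u * f + v * Polynomial.derivative f = Polynomial.C r := by
  obtain ⟨_⟩ : Nonempty (NormalizedGCDMonoid R) := inferInstance
  have hf0 : f ≠ 0 := hf.ne_zero
  let K := FractionRing R
  have hinj : Function.Injective (algebraMap R K) := IsFractionRing.injective R K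
  have : CharZero K := charZero_of_injective_algebraMap hinj
  have hc0 : algebraMap R K f.content ≠ 0 := by
    rw [Ne, map_eq_zero_iff _ hinj, Polynomial.content_eq_zero_iff]; exact hf0
  -- Gauss's lemma: the square of a factor over the fraction field is associated to the square of a
  -- primitive polynomial, whose divisibility descends to `R`.
  have hsq : Squarefree (f.primPart.map (algebraMap R K)) := by
    intro q hq
    have hpp0 : f.primPart.map (algebraMap R K) ≠ 0 :=
      (Polynomial.map_ne_zero_iff hinj).2 f.primPart_ne_zero
    have hq0 : q ≠ 0 := fun h => hpp0 (by simpa [h] using hq)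
    obtain ⟨b, hbm, hb⟩ := IsLocalization.integerNormalization_spec (nonZeroDivisors R) q
    set q₀ := IsLocalization.integerNormalization (nonZeroDivisors R) q with hq₀
    have hb0 : algebraMap R K b ≠ 0 := by
      rw [Ne, map_eq_zero_iff _ hinj]; exact nonZeroDivisors.ne_zero hbm
    have hq₀0 : q₀ ≠ 0 := by
      rintro h
      rw [h, Polynomial.map_zero] at hb
      have : (algebraMap R K b) • q = 0 := by rw [algebraMap_smul]; exact hb.symm
      exact (smul_ne_zero hb0 hq0) this
    have hc : algebraMap R K q₀.content ≠ 0 := by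
      rw [Ne, map_eq_zero_iff _ hinj, Polynomial.content_eq_zero_iff]; exact hq₀0
    set q₁ := q₀.primPart
    have h1 : Associated (q₁.map (algebraMap R K)) q := by
      have h2 : Polynomial.C (algebraMap R K q₀.content) * q₁.map (algebraMap R K) =
          Polynomial.C (algebraMap R K b) * q := by
        rw [← Polynomial.map_C, ← Polynomial.map_mul, ← q₀.eq_C_content_mul_primPart, hb,
          ← Polynomial.smul_eq_C_mul, algebraMap_smul]
      have hu1 : IsUnit (Polynomial.C (algebraMap R K q₀.content)) :=
        Polynomial.isUnit_C.2 (isUnit_iff_ne_zero.2 hc)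
      have hu2 : IsUnit (Polynomial.C (algebraMap R K b)) :=
        Polynomial.isUnit_C.2 (isUnit_iff_ne_zero.2 hb0)
      exact ((associated_unit_mul_left _ _ hu1).symm.trans (Associated.of_eq h2)).trans
        (associated_unit_mul_left _ _ hu2)
    have hprim : q₁.IsPrimitive := q₀.isPrimitive_primPart
    have h3 : q₁ * q₁ ∣ f.primPart := by
      refine (hprim.mul hprim).dvd_of_fraction_map_dvd_fraction_map (K := K) ?_
      rw [Polynomial.map_mul]
      exact ((h1.mul_mul h1).dvd).trans hq
    have h4 : IsUnit q₁ := hf q₁ (h3.trans f.primPart_dvd)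
    exact h1.isUnit (h4.map (Polynomial.mapRingHom (algebraMap R K)))
  -- In characteristic zero squarefree means separable, which is a Bezout identity over the fraction
  -- field; clearing denominators and restoring the content produces the constant.
  obtain ⟨u, v, huv⟩ := PerfectField.separable_iff_squarefree.2 hsq
  obtain ⟨b, hbm, hb⟩ := IsLocalization.integerNormalization_spec (nonZeroDivisors R) u
  obtain ⟨c, hcm, hc⟩ := IsLocalization.integerNormalization_spec (nonZeroDivisors R) v
  set U := IsLocalization.integerNormalization (nonZeroDivisors R) u
  set V := IsLocalization.integerNormalization (nonZeroDivisors R) v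
  have hsm : ∀ (b : R) (p : Polynomial K), b • p = Polynomial.C (algebraMap R K b) * p := by
    intro b p
    rw [← Polynomial.smul_eq_C_mul, algebraMap_smul]
  have hb' : U.map (algebraMap R K) = Polynomial.C (algebraMap R K b) * u := by
    rw [hb, ← hsm]
  have hc' : V.map (algebraMap R K) = Polynomial.C (algebraMap R K c) * v := by
    rw [hc, ← hsm]
  refine ⟨b * c * f.content, Polynomial.C c * U, Polynomial.C b * V, ?_, ?_⟩
  · refine mul_ne_zero (mul_ne_zero (nonZeroDivisors.ne_zero hbm) (nonZeroDivisors.ne_zero hcm)) ?_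
    rwa [Ne, Polynomial.content_eq_zero_iff]
  · refine Polynomial.map_injective _ hinj ?_
    have hfm : f.map (algebraMap R K) =
        Polynomial.C (algebraMap R K f.content) * f.primPart.map (algebraMap R K) := by
      conv_lhs => rw [f.eq_C_content_mul_primPart, Polynomial.map_mul, Polynomial.map_C]
    simp only [Polynomial.map_add, Polynomial.map_mul, Polynomial.map_C, hb', hc',
      ← Polynomial.derivative_map, hfm, Polynomial.derivative_mul, Polynomial.derivative_C,
      map_mul]
    linear_combination (Polynomial.C (algebraMap R K b) * Polynomial.C (algebraMap R K c) *
      Polynomial.C (algebraMap R K f.content)) * huv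

theorem _root_.Squarefree.map_algEquiv {R A B : Type*} [CommSemiring R] [CommSemiring A]
    [CommSemiring B] [Algebra R A] [Algebra R B] {f : A} (hf : Squarefree f) (e : A ≃ₐ[R] B) :
    Squarefree (e f) := by
  intro x hx
  have h : e.symm x * e.symm x ∣ f := by
    simpa using map_dvd e.symm hx
  simpa using (hf _ h).map e

theorem derivative_finSuccEquiv {n : ℕ} (F : MvPolynomial (Fin (n + 1)) ℂ) :
    Polynomial.derivative (finSuccEquiv ℂ n F) = finSuccEquiv ℂ n (pderiv 0 F) := by
  induction F using MvPolynomial.induction_on with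
  | C a => simp [finSuccEquiv_apply]
  | add p q hp hq => simp [hp, hq]
  | mul_X p i hp =>
    rw [map_mul, Polynomial.derivative_mul, hp, Derivation.leibniz, pderiv_X]
    refine Fin.cases ?_ (fun j => ?_) i
    · simp [finSuccEquiv_X_zero]; ring
    · simp [finSuccEquiv_X_succ]; ring

/-- As a polynomial in `z_0` over `ℂ[z_1, z_2]`, `F` is still squarefree and its derivative is
`∂F/∂z_0`. The constant `r` in the ideal generated by both plays the role of a discriminant. -/
theorem exists_elimination_zero {F : MvPolynomial (Fin 3) ℂ} (hF : Squarefree F) :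
    ∃ r : MvPolynomial (Fin 2) ℂ, r ≠ 0 ∧ ∀ (x : ℂ) (y : Fin 2 → ℂ),
      eval (Fin.cons x y : Fin 3 → ℂ) F = 0 → eval (Fin.cons x y : Fin 3 → ℂ) (pderiv 0 F) = 0 →
      eval y r = 0 := by
  have hsq := hF.map_algEquiv (finSuccEquiv ℂ 2)
  obtain ⟨r, u, v, hr, h⟩ := hsq.exists_mul_add_mul_derivative_eq_C
  refine ⟨r, hr, fun x y h1 h2 => ?_⟩
  have := congrArg (fun p => Polynomial.eval x (Polynomial.map (eval y) p)) h
  rw [derivative_finSuccEquiv] at this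
  simp only [Polynomial.map_add, Polynomial.map_mul, Polynomial.eval_add, Polynomial.eval_mul,
    ← eval_eq_eval_mv_eval', h1, h2, Polynomial.map_C, Polynomial.eval_C] at this
  simpa using this.symm

theorem exists_elimination {F : MvPolynomial (Fin 3) ℂ} (hF : Squarefree F) (l : Fin 3) :
    ∃ r : MvPolynomial (Fin 2) ℂ, r ≠ 0 ∧ ∀ z : Fin 3 → ℂ, eval z F = 0 →
      eval z (pderiv l F) = 0 → eval (fun j : Fin 2 => z (Equiv.swap 0 l j.succ)) r = 0 := by
  set e := Equiv.swap 0 l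
  obtain ⟨r, hr, h⟩ := exists_elimination_zero (hF.map_algEquiv (renameEquiv ℂ e))
  refine ⟨r, hr, fun z h1 h2 => ?_⟩
  have hz : (Fin.cons (z (e 0)) fun j : Fin 2 => z (e j.succ) : Fin 3 → ℂ) ∘ e = z := by
    ext i
    have : (Fin.cons (z (e 0)) fun j : Fin 2 => z (e j.succ) : Fin 3 → ℂ) = z ∘ e := by
      ext j; refine Fin.cases ?_ (fun j => ?_) j <;> rfl
    rw [this]
    simp [e]
  have he : e l = 0 := Equiv.swap_apply_right 0 l
  have hd : pderiv 0 (rename e F) = rename e (pderiv l F) := by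
    rw [← he, pderiv_rename e.injective]
  refine h (z (e 0)) _ ?_ ?_
  · rw [renameEquiv_apply, eval_rename, hz, h1]
  · rw [renameEquiv_apply, hd, eval_rename, hz, h2]

/-- Since `r` is not known to be homogeneous, vanishing is assumed on whole lines through the
origin. Restricting `r` to the affine line `y m = const`, for a suitable constant, is then enough.
-/
theorem exists_polynomial_of_vanish_on_lines {r : MvPolynomial (Fin 2) ℂ} (hr : r ≠ 0)
    {m m' : Fin 2} (hm : m ≠ m') :
    ∃ ρ : Polynomial ℂ, ρ ≠ 0 ∧ ∀ y : Fin 2 → ℂ, y m = 1 → (∀ c : ℂ, eval (c • y) r = 0) →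
      ρ.eval (y m') = 0 := by
  -- The factor `X m` forces `y₀ m ≠ 0`, so `y₀` lies on the chosen line and witnesses `ρ ≠ 0`.
  obtain ⟨y₀, hy₀⟩ : ∃ y, eval y (r * X m) ≠ 0 := by
    by_contra! h
    exact mul_ne_zero hr (X_ne_zero m) (MvPolynomial.funext fun y => by simp [h y])
  rw [map_mul, eval_X] at hy₀
  set ρ : Polynomial ℂ := aeval (fun n => if n = m then Polynomial.C (y₀ m) else
    Polynomial.C (y₀ m) * Polynomial.X) r with hρ
  have key : ∀ y : Fin 2 → ℂ, y m = 1 → ρ.eval (y m') = eval (y₀ m • y) r := by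
    intro y hy
    have h1 : ρ.eval (y m') = Polynomial.evalRingHom (y m') ρ := rfl
    rw [h1, hρ, ← MvPolynomial.aeval_eq_eval, MvPolynomial.aeval_def, MvPolynomial.aeval_def,
      MvPolynomial.hom_eval₂]
    congr 1
    · ext; simp
    · ext n
      by_cases hn : n = m
      · subst hn; simp [hy]
      · have : n = m' := by omega
        subst this
        simp [hn]
  refine ⟨ρ, fun h => ?_, fun y hy hc => (key y hy).trans (hc _)⟩
  have h0 : y₀ m ≠ 0 := right_ne_zero_of_mul hy₀
  have := key ((y₀ m)⁻¹ • y₀) (by simp [h0])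
  rw [h, Polynomial.eval_zero, smul_smul, mul_inv_cancel₀ h0, one_smul] at this
  exact left_ne_zero_of_mul hy₀ this.symm

/-- In the chart `z_i = 1`, eliminating the third variable `l` confines the coordinate `z_j` of a
singular point to the roots of a nonzero polynomial. Countability suffices for a generic curve to
avoid these points. -/
theorem countable_singLocus {F : MvPolynomial (Fin 3) ℂ} {k : ℕ} (hk : F.IsHomogeneous k)
    (hF : Squarefree F) : (singLocus F).Countable := by
  have h1 : ∀ i j : Fin 3, ∃ s : Set ℂ, s.Countable ∧
      ∀ p ∈ singLocus F, p ∈ affineOpen i → chart i p j ∈ s := by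
    intro i j
    by_cases hij : i = j
    · subst hij
      exact ⟨{1}, countable_singleton 1, fun p _ hp => chart_self hp⟩
    obtain ⟨l, hli, hlj⟩ : ∃ l, l ≠ i ∧ l ≠ j := by revert i j; decide
    obtain ⟨m, m', hm, hmi, hmj⟩ : ∃ m m' : Fin 2, m ≠ m' ∧ Equiv.swap 0 l m.succ = i ∧
        Equiv.swap 0 l m'.succ = j := by revert i j l; decide
    obtain ⟨r, hr, h⟩ := exists_elimination hF l
    obtain ⟨ρ, hρ, h'⟩ := exists_polynomial_of_vanish_on_lines hr hm
    refine ⟨{x | ρ.IsRoot x}, (Polynomial.finite_setOfPred_isRoot hρ).countable, fun p hp hpi => ?_⟩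
    have h2 := h' (fun n => chart i p (Equiv.swap 0 l n.succ)) (by rw [hmi, chart_self hpi])
    rw [hmj] at h2
    rw [← proj_chart hpi, proj_mem_singLocus hk (chart_ne_zero hpi)] at hp
    refine h2 fun c => h (c • chart i p) ?_ ?_
    · rw [eval_smul_of_isHomogeneous hk, hp.1, mul_zero]
    · rw [eval_smul_of_isHomogeneous hk.pderiv, hp.2, mul_zero]
  choose s hs h using h1
  have h2 : singLocus F ⊆ ⋃ i, proj '' (Set.univ.pi (s i)) := by
    intro p hp
    obtain ⟨i, hi⟩ := exists_mem_affineOpen p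
    exact mem_iUnion.2 ⟨i, chart i p, fun j _ => h i j p hp hi, proj_chart hi⟩
  exact (countable_iUnion fun i => (Set.countable_univ_pi (hs i)).image _).mono h2

/-- Having positive degree, `F` involves some `z_l`. Specialize the other variables so that the
leading coefficient and the eliminant `r` do not vanish: a root in `z_l` exists and `∂F/∂z_l ≠ 0`
there. -/
theorem exists_regular_point {F : MvPolynomial (Fin 3) ℂ} {k : ℕ} (hk : F.IsHomogeneous k)
    (hk1 : 1 ≤ k) (hF : Squarefree F) :
    ∃ z : Fin 3 → ℂ, z ≠ 0 ∧ eval z F = 0 ∧ ∃ l, eval z (pderiv l F) ≠ 0 := by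
  obtain ⟨m, hm⟩ := (MvPolynomial.support_nonempty).2 hF.ne_zero
  obtain ⟨l, hl⟩ : ∃ l, m l ≠ 0 := by
    by_contra! h
    have h2 := hk.degree_eq_sum_deg_support hm
    rw [Finset.sum_eq_zero fun i _ => h i] at h2
    omega
  have hdeg : degreeOf l F ≠ 0 := by
    have := monomial_le_degreeOf l hm
    omega
  set e := Equiv.swap 0 l
  have he : e l = 0 := Equiv.swap_apply_right 0 l
  set F' := rename e F with hF'
  obtain ⟨r, hr, h⟩ := exists_elimination_zero (hF.map_algEquiv (renameEquiv ℂ e))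
  rw [renameEquiv_apply, ← hF'] at h
  have hdeg' : (finSuccEquiv ℂ 2 F').natDegree ≠ 0 := by
    rw [natDegree_finSuccEquiv, hF', ← he, degreeOf_rename_of_injective e.injective]
    exact hdeg
  have hlc : (finSuccEquiv ℂ 2 F').leadingCoeff ≠ 0 := by
    rw [Polynomial.leadingCoeff_ne_zero]
    rintro h0
    simp [h0] at hdeg'
  -- The extra factor `X 0` ensures that the point found is not the origin of `ℂ³`.
  obtain ⟨y, hy⟩ : ∃ y, eval y ((finSuccEquiv ℂ 2 F').leadingCoeff * r * X 0) ≠ 0 := by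
    by_contra! h
    exact mul_ne_zero (mul_ne_zero hlc hr) (X_ne_zero 0)
      (MvPolynomial.funext fun y => by simp [h y])
  rw [map_mul, map_mul, eval_X] at hy
  have hd : ((finSuccEquiv ℂ 2 F').map (eval y)).natDegree = (finSuccEquiv ℂ 2 F').natDegree :=
    Polynomial.natDegree_map_of_leadingCoeff_ne_zero _
      (left_ne_zero_of_mul (left_ne_zero_of_mul hy))
  obtain ⟨x, hx⟩ := IsAlgClosed.exists_root ((finSuccEquiv ℂ 2 F').map (eval y)) (fun h0 => by
    rw [Polynomial.natDegree_eq_of_degree_eq_some h0] at hd; exact hdeg' hd.symm)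
  set w : Fin 3 → ℂ := Fin.cons x y with hw
  have hw1 : eval w F' = 0 := by rw [eval_eq_eval_mv_eval']; exact hx
  have hw2 : eval w (pderiv 0 F') ≠ 0 := fun h0 =>
    right_ne_zero_of_mul (left_ne_zero_of_mul hy) (h x y hw1 h0)
  rw [hF', eval_rename] at hw1
  rw [hF', ← he, pderiv_rename e.injective, eval_rename] at hw2
  refine ⟨w ∘ e, fun h0 => right_ne_zero_of_mul hy ?_, hw1, l, hw2⟩
  have := congrFun h0 (e.symm 1)
  simpa [hw] using this

end CP2

namespace CP2

/-! ### A flat function with infinitely many nondegenerate zeros -/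

/-- The function `exp(-1/s) exp(i/s) P(1/s)` for `s > 0`, extended by zero. -/
def flatOsc (P : Polynomial ℂ) (s : ℝ) : ℂ :=
  (expNegInvGlue s : ℂ) *
    (Complex.exp (Complex.I * (s⁻¹ : ℝ)) * P.eval ((s⁻¹ : ℝ) : ℂ))

theorem norm_flatOsc (P : Polynomial ℂ) (s : ℝ) :
    ‖flatOsc P s‖ = ‖(expNegInvGlue s : ℂ) * P.eval ((s⁻¹ : ℝ) : ℂ)‖ := by
  have : ‖Complex.exp (Complex.I * (s⁻¹ : ℝ))‖ = 1 := by
    rw [mul_comm]; exact Complex.norm_exp_ofReal_mul_I _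
  rw [flatOsc, norm_mul, norm_mul, this, one_mul, norm_mul]

theorem tendsto_flatOsc (P : Polynomial ℂ) : Tendsto (flatOsc P) (𝓝 0) (𝓝 0) := by
  rw [tendsto_zero_iff_norm_tendsto_zero]
  simp only [norm_flatOsc]
  rw [← tendsto_zero_iff_norm_tendsto_zero]
  induction P using Polynomial.induction_on' with
  | add p q hp hq => simpa [mul_add] using hp.add hq
  | monomial n a =>
    have h := expNegInvGlue.tendsto_polynomial_inv_mul_zero (Polynomial.X ^ n)
    have h2 : Tendsto (fun x : ℝ => a * (((Polynomial.X ^ n : Polynomial ℝ).eval x⁻¹ *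
        expNegInvGlue x : ℝ) : ℂ)) (𝓝 0) (𝓝 (a * ((0 : ℝ) : ℂ))) :=
      ((Complex.continuous_ofReal.tendsto 0).comp h).const_mul a
    rw [Complex.ofReal_zero, mul_zero] at h2
    refine h2.congr fun x => ?_
    simp
    ring

theorem flatOsc_of_nonpos (P : Polynomial ℂ) {s : ℝ} (hs : s ≤ 0) : flatOsc P s = 0 := by
  simp [flatOsc, expNegInvGlue.zero_of_nonpos hs]

/-- For `s > 0` the function is `exp((i-1)/s) P(1/s)`, whose derivative is `exp((i-1)/s) s⁻² ((1-i)P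
- P')(1/s)`. At `0` the slopes are again of this type, with polynomial `X P`, and tend to `0`. The
family is thus closed under differentiation, hence consists of smooth functions. -/
theorem hasDerivAt_flatOsc (P : Polynomial ℂ) (s : ℝ) :
    HasDerivAt (flatOsc P) (flatOsc (Polynomial.X ^ 2 *
      (Polynomial.C (1 - Complex.I) * P - Polynomial.derivative P)) s) s := by
  rcases lt_trichotomy s 0 with hs | rfl | hs
  · rw [flatOsc_of_nonpos _ hs.le]
    refine (hasDerivAt_const s 0).congr_of_eventuallyEq ?_
    filter_upwards [gt_mem_nhds hs] with x hx
    exact flatOsc_of_nonpos _ hx.le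
  · rw [flatOsc_of_nonpos _ le_rfl, hasDerivAt_iff_tendsto_slope]
    refine ((tendsto_flatOsc (Polynomial.X * P)).mono_left nhdsWithin_le_nhds).congr' ?_
    filter_upwards with x
    simp [slope_def_module, flatOsc]
    ring
  · have h1 : HasDerivAt (fun x : ℝ => ((x⁻¹ : ℝ) : ℂ)) ((-(s ^ 2)⁻¹ : ℝ) : ℂ) s :=
      (hasDerivAt_inv hs.ne').ofReal_comp
    have h2 : HasDerivAt (fun x : ℝ => Complex.exp ((Complex.I - 1) * ((x⁻¹ : ℝ) : ℂ))) _ s :=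
      (h1.const_mul (Complex.I - 1)).cexp
    have h3 : HasDerivAt (fun x : ℝ => P.eval ((x⁻¹ : ℝ) : ℂ)) _ s :=
      (P.hasDerivAt _).comp s h1
    have hexp : ∀ x : ℝ, 0 < x → ((expNegInvGlue x : ℝ) : ℂ) *
        Complex.exp (Complex.I * (x⁻¹ : ℝ)) =
        Complex.exp ((Complex.I - 1) * ((x⁻¹ : ℝ) : ℂ)) := by
      intro x hx
      rw [expNegInvGlue, if_neg hx.not_ge, Complex.ofReal_exp, ← Complex.exp_add]
      congr 1
      push_cast
      ring
    have h4 : HasDerivAt (fun x : ℝ => Complex.exp ((Complex.I - 1) * ((x⁻¹ : ℝ) : ℂ)) *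
        P.eval ((x⁻¹ : ℝ) : ℂ)) _ s := h2.mul h3
    have h5 := h4.congr_of_eventuallyEq (f₁ := flatOsc P) (by
      filter_upwards [lt_mem_nhds hs] with x hx
      change _ * (_ * _) = _
      rw [← mul_assoc, hexp x hx])
    refine h5.congr_deriv ?_
    symm
    change _ * (_ * _) = _
    rw [← mul_assoc, hexp s hs]
    simp
    ring

theorem contDiff_flatOsc (P : Polynomial ℂ) : ContDiff ℝ ∞ (flatOsc P) := by
  refine contDiff_infty.2 fun n => ?_
  induction n generalizing P with
  | zero =>
    exact contDiff_zero.2 (continuous_iff_continuousAt.2 fun s =>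
      (hasDerivAt_flatOsc P s).continuousAt)
  | succ n ih =>
    rw [Nat.cast_succ, contDiff_succ_iff_deriv]
    refine ⟨fun s => (hasDerivAt_flatOsc P s).differentiableAt, by simp, ?_⟩
    rw [show deriv (flatOsc P) = _ from funext fun s => (hasDerivAt_flatOsc P s).deriv]
    exact ih _

/-- For `Re x > 0` the witness is `u(x) = e^(-1/s) sin(1/s) + i Im x` with `s = Re x`. The zeros
`1/(π(n+1))` are simple in `s`, and the term `i Im x` makes the differential injective. -/
theorem exists_smooth_accumulating_zeros :
    ∃ (u : ℂ → ℂ) (s : ℕ → ℂ), ContDiff ℝ ∞ u ∧ Function.Injective s ∧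
      Tendsto s atTop (𝓝 0) ∧ ∀ n, u (s n) = 0 ∧ Function.Injective (fderiv ℝ u (s n)) := by
  have hpos : ∀ n : ℕ, (0 : ℝ) < Real.pi * (n + 1) := fun n => by positivity
  refine ⟨fun x => ((flatOsc 1 x.re).im : ℂ) + Complex.I * x.im,
    fun n => (((Real.pi * (n + 1))⁻¹ : ℝ) : ℂ), ?_, ?_, ?_, fun n => ?_⟩
  · have h1 : ContDiff ℝ ∞ fun x : ℂ => flatOsc 1 x.re :=
      (contDiff_flatOsc 1).comp Complex.reCLM.contDiff
    have h2 : ContDiff ℝ ∞ fun x : ℂ => ((flatOsc 1 x.re).im : ℂ) :=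
      Complex.ofRealCLM.contDiff.comp (Complex.imCLM.contDiff.comp h1)
    have h3 : ContDiff ℝ ∞ fun x : ℂ => (x.im : ℂ) :=
      Complex.ofRealCLM.contDiff.comp Complex.imCLM.contDiff
    exact h2.add (contDiff_const.mul h3)
  · intro m n h
    have h1 := inv_injective (Complex.ofReal_injective h)
    have h2 := mul_left_cancel₀ Real.pi_ne_zero h1
    exact_mod_cast add_right_cancel h2
  · rw [← Complex.ofReal_zero]
    refine (Complex.continuous_ofReal.tendsto 0).comp ?_
    refine tendsto_inv_atTop_zero.comp (Tendsto.const_mul_atTop Real.pi_pos ?_)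
    exact tendsto_atTop_add_const_right _ _ tendsto_natCast_atTop_atTop
  · have hexp : Complex.exp (Complex.I * ((Real.pi * (n + 1) : ℝ) : ℂ)) = (-1) ^ (n + 1) := by
      rw [show Complex.I * ((Real.pi * (n + 1) : ℝ) : ℂ) =
        ((n + 1 : ℕ) : ℂ) * (Real.pi * Complex.I) by push_cast; ring, Complex.exp_nat_mul,
        Complex.exp_pi_mul_I]
    have hval : ∀ P : Polynomial ℂ, flatOsc P (Real.pi * (n + 1))⁻¹ =
        (expNegInvGlue (Real.pi * (n + 1))⁻¹ : ℂ) *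
          ((-1) ^ (n + 1) * P.eval ((Real.pi * (n + 1) : ℝ) : ℂ)) := by
      intro P
      rw [flatOsc, inv_inv, hexp]
    have hreal : ((-1 : ℂ) ^ (n + 1)) = (((-1 : ℝ) ^ (n + 1) : ℝ) : ℂ) := by push_cast; rfl
    have hglue : expNegInvGlue (Real.pi * (n + 1))⁻¹ ≠ 0 :=
      (expNegInvGlue.pos_of_pos (inv_pos.2 (hpos n))).ne'
    constructor
    · simp only [Complex.ofReal_re, Complex.ofReal_im, hval, Polynomial.eval_one, mul_one, hreal,
        ← Complex.ofReal_mul]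
      simp
    · set t := (Real.pi * (n + 1))⁻¹ with ht
      set D := flatOsc (Polynomial.X ^ 2 * (Polynomial.C (1 - Complex.I) * 1 -
        Polynomial.derivative 1)) t with hD
      -- At these points the oscillating factor is `±1`; the only nonreal factor of the derivative
      -- is `1 - i`.
      have hDim : D.im ≠ 0 := by
        rw [hD, hval, hreal]
        simp only [Polynomial.eval_mul, Polynomial.eval_pow, Polynomial.eval_X,
          Polynomial.derivative_one, sub_zero, mul_one, Polynomial.eval_C]
        rw [← Complex.ofReal_pow, Complex.im_ofReal_mul, Complex.im_ofReal_mul,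
          Complex.im_ofReal_mul]
        refine mul_ne_zero hglue (mul_ne_zero (pow_ne_zero _ (by norm_num))
          (mul_ne_zero (pow_ne_zero _ (hpos n).ne') (by simp)))
      have h1 : HasFDerivAt (fun x : ℂ => flatOsc 1 x.re)
          ((ContinuousLinearMap.toSpanSingleton ℝ D).comp Complex.reCLM) (t : ℂ) :=
        HasFDerivAt.comp (t : ℂ) (g := flatOsc 1) (f := fun x : ℂ => x.re)
          (hasDerivAt_flatOsc 1 _).hasFDerivAt Complex.reCLM.hasFDerivAt
      have h2 : HasFDerivAt (fun x : ℂ => ((flatOsc 1 x.re).im : ℂ))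
          (Complex.ofRealCLM.comp (Complex.imCLM.comp
            ((ContinuousLinearMap.toSpanSingleton ℝ D).comp Complex.reCLM))) (t : ℂ) :=
        Complex.ofRealCLM.hasFDerivAt.comp (t : ℂ) (Complex.imCLM.hasFDerivAt.comp (t : ℂ) h1)
      have h3 : HasFDerivAt (fun x : ℂ => (x.im : ℂ)) (Complex.ofRealCLM.comp Complex.imCLM)
          (t : ℂ) := (Complex.ofRealCLM.comp Complex.imCLM).hasFDerivAt
      have h4 := h2.add (h3.const_mul Complex.I)
      refine (injective_iff_map_eq_zero _).2 fun v hv => ?_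
      erw [h4.fderiv] at hv
      have hre := congrArg Complex.re hv
      have him := congrArg Complex.im hv
      simp at hre him
      apply Complex.ext
      · simpa [hDim] using hre
      · simpa using him

end CP2

namespace CP2

open scoped NNReal

/-! ### Perturbations of the identity -/

/-- Vector fields `P` on `ℂ³` which are smooth away from the origin and homogeneous of degree one,
such that `z ↦ z + t P z` induces a self-map of `CP²` for all real `t`. -/
structure IsHomPerturbation (P : (Fin 3 → ℂ) → Fin 3 → ℂ) : Prop where
  smooth : ∀ z, z ≠ 0 → ContDiffAt ℝ ∞ P z
  hom : ∀ (c : ℂ) z, P (c • z) = c • P z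
  ne_zero : ∀ (t : ℝ) z, z ≠ 0 → z + t • P z ≠ 0

/-- The self-map of `CP²` induced by `z ↦ z + t P z`. -/
def pertMap (P : (Fin 3 → ℂ) → Fin 3 → ℂ) (t : ℝ) (p : CP2) : CP2 := proj (p.rep + t • P p.rep)

namespace IsHomPerturbation

variable {P : (Fin 3 → ℂ) → Fin 3 → ℂ} (hP : IsHomPerturbation P)
include hP

theorem real_hom (r : ℝ) (z : Fin 3 → ℂ) : P (r • z) = r • P z := by
  have := hP.hom (r : ℂ) z
  simpa only [Complex.coe_smul] using this

theorem map_zero : P 0 = 0 := by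
  simpa using hP.hom 0 0

theorem hasFDerivAt {z : Fin 3 → ℂ} (hz : z ≠ 0) : HasFDerivAt P (fderiv ℝ P z) z :=
  ((hP.smooth z hz).differentiableAt (by simp)).hasFDerivAt

theorem fderiv_smul {z : Fin 3 → ℂ} (hz : z ≠ 0) {r : ℝ} (hr : r ≠ 0) :
    fderiv ℝ P (r • z) = fderiv ℝ P z := by
  have hrz : r • z ≠ 0 := smul_ne_zero hr hz
  have h1 : HasFDerivAt (fun y : Fin 3 → ℂ => r • y)
      (r • ContinuousLinearMap.id ℝ (Fin 3 → ℂ)) z := (hasFDerivAt_id z).const_smul r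
  have h2 : HasFDerivAt (fun y => P (r • y)) _ z := (hP.hasFDerivAt hrz).comp z h1
  have h3 : HasFDerivAt (fun y => P (r • y)) (r • fderiv ℝ P z) z := by
    simp only [hP.real_hom]
    exact (hP.hasFDerivAt hz).const_smul r
  have h4 := h2.unique h3
  ext1 v
  have := congrArg (fun L => L v) h4
  simp at this
  exact smul_right_injective _ hr this

/-- Euler's relation: on the complex line through `z` the field `P` is linear. Consequently radial
directions are sent to radial directions by the differential of `z + t P z`. -/
theorem fderiv_apply_smul_self {z : Fin 3 → ℂ} (hz : z ≠ 0) (c : ℂ) :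
    fderiv ℝ P z (c • z) = c • P z := by
  have h1 : HasDerivAt (fun s : ℝ => z + s • (c • z)) (c • z) 0 := by
    simpa using ((hasDerivAt_id (0 : ℝ)).smul_const (c • z)).const_add z
  have h2 : HasDerivAt (fun s : ℝ => P z + s • (c • P z)) (c • P z) 0 := by
    simpa using ((hasDerivAt_id (0 : ℝ)).smul_const (c • P z)).const_add (P z)
  have h3 : HasDerivAt (fun s : ℝ => P (z + s • (c • z))) (fderiv ℝ P z (c • z)) 0 := by
    refine HasFDerivAt.comp_hasDerivAt (0 : ℝ) ?_ h1
    simpa using hP.hasFDerivAt hz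
  refine h3.unique (h2.congr_of_eventuallyEq (Eventually.of_forall fun s => ?_))
  have : z + s • (c • z) = (1 + (s : ℂ) * c) • z := by
    rw [add_smul, one_smul, mul_smul, Complex.coe_smul]
  simp only [this, hP.hom]
  rw [add_smul, one_smul, mul_smul, Complex.coe_smul]

/-- By homogeneity, bounds for `P` and its differential on the unit sphere hold everywhere, linearly
for `P`. The mean value inequality applies on segments avoiding `0`, where alone `P` may fail to be
differentiable. -/
theorem exists_lipschitzWith : ∃ M : ℝ≥0, LipschitzWith M P := by
  have hsph : ∀ z ∈ Metric.sphere (0 : Fin 3 → ℂ) 1, z ≠ 0 := fun z hz =>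
    ne_zero_of_mem_sphere one_ne_zero ⟨z, hz⟩
  have hnorm : ∀ z : Fin 3 → ℂ, z ≠ 0 → ‖z‖⁻¹ • z ∈ Metric.sphere (0 : Fin 3 → ℂ) 1 := by
    intro z hz
    simp [norm_smul, hz]
  obtain ⟨M₁, h1⟩ := (isCompact_sphere (0 : Fin 3 → ℂ) 1).exists_bound_of_continuousOn
    (f := fderiv ℝ P) fun z hz =>
      ((hP.smooth z (hsph z hz)).continuousAt_fderiv (by simp)).continuousWithinAt
  obtain ⟨M₂, h2⟩ := (isCompact_sphere (0 : Fin 3 → ℂ) 1).exists_bound_of_continuousOn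
    (f := P) fun z hz => (hP.smooth z (hsph z hz)).continuousAt.continuousWithinAt
  set M : ℝ≥0 := (max M₁ M₂).toNNReal with hM
  have hM₁ : M₁ ≤ M := (le_max_left _ _).trans (Real.le_coe_toNNReal _)
  have hM₂ : M₂ ≤ M := (le_max_right _ _).trans (Real.le_coe_toNNReal _)
  have h3 : ∀ z, z ≠ 0 → ‖fderiv ℝ P z‖ ≤ M := by
    intro z hz
    rw [← hP.fderiv_smul hz (inv_ne_zero (norm_ne_zero_iff.2 hz))]
    exact (h1 _ (hnorm z hz)).trans hM₁
  have h4 : ∀ z, ‖P z‖ ≤ M * ‖z‖ := by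
    intro z
    by_cases hz : z = 0
    · simp [hz, hP.map_zero]
    have h5 := (h2 _ (hnorm z hz)).trans hM₂
    rw [hP.real_hom, norm_smul, norm_inv, norm_norm, inv_mul_le_iff₀ (norm_pos_iff.2 hz)] at h5
    linarith
  refine ⟨M, LipschitzWith.of_dist_le_mul fun z w => ?_⟩
  -- On a segment through `0` one has `‖z - w‖ = ‖z‖ + ‖w‖`, so linear growth of `P` suffices.
  by_cases h0 : (0 : Fin 3 → ℂ) ∈ segment ℝ z w
  · have h5 := dist_add_dist_of_mem_segment h0
    rw [dist_zero_right, dist_zero_left] at h5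
    rw [← h5, dist_eq_norm]
    calc ‖P z - P w‖ ≤ ‖P z‖ + ‖P w‖ := norm_sub_le _ _
      _ ≤ M * ‖z‖ + M * ‖w‖ := add_le_add (h4 z) (h4 w)
      _ = M * (‖z‖ + ‖w‖) := by ring
  · rw [dist_eq_norm, dist_eq_norm]
    have hne : ∀ x ∈ segment ℝ z w, x ≠ 0 := fun x hx h => h0 (h ▸ hx)
    exact (convex_segment z w).norm_image_sub_le_of_norm_hasFDerivWithin_le
      (fun x hx => (hP.hasFDerivAt (hne x hx)).hasFDerivWithinAt) (fun x hx => h3 x (hne x hx))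
      (right_mem_segment ℝ z w) (left_mem_segment ℝ z w)

theorem pertMap_proj (t : ℝ) {z : Fin 3 → ℂ} (hz : z ≠ 0) :
    pertMap P t (proj z) = proj (z + t • P z) := by
  obtain ⟨c, hc, h⟩ := exists_rep_proj hz
  have : c • z + t • P (c • z) = c • (z + t • P z) := by
    rw [hP.hom, smul_add, smul_comm t c]
  rw [pertMap, h, this, proj_smul (hP.ne_zero t z hz) hc]

theorem smoothAt_pertMap {E : Type*} [NormedAddCommGroup E] [NormedSpace ℝ E] {f : E → CP2}
    {τ : E → ℝ} {x : E} (hf : SmoothAt f x) (hτ : ContDiffAt ℝ ∞ τ x) :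
    SmoothAt (fun y => pertMap P (τ y) (f y)) x := by
  obtain ⟨z, hz, h0, h⟩ := hf.exists_lift
  refine smoothAt_of_lift (z := fun y => z y + τ y • P (z y)) ?_ (hP.ne_zero _ _ h0) ?_
  · exact hz.add (hτ.smul ((hP.smooth _ h0).comp x hz))
  · filter_upwards [h, hz.continuousAt.eventually_ne h0] with y h1 h2
    rw [h1, hP.pertMap_proj _ h2]

theorem hasFDerivAt_pert (t : ℝ) {z : Fin 3 → ℂ} (hz : z ≠ 0) :
    HasFDerivAt (fun z => z + t • P z) (ContinuousLinearMap.id ℝ _ + t • fderiv ℝ P z) z :=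
  (hasFDerivAt_id z).add ((hP.hasFDerivAt hz).const_smul t)

theorem contDiffAt_pert (t : ℝ) {z : Fin 3 → ℂ} (hz : z ≠ 0) :
    ContDiffAt ℝ ∞ (fun z => z + t • P z) z :=
  contDiffAt_id.add ((hP.smooth z hz).const_smul t)

omit hP in
theorem injective_pert_deriv {M : ℝ≥0} (hM : LipschitzWith M P) {t : ℝ} (ht : |t| * M < 1)
    (z : Fin 3 → ℂ) : Function.Injective
      (ContinuousLinearMap.id ℝ (Fin 3 → ℂ) + t • fderiv ℝ P z) := by
  refine (injective_iff_map_eq_zero _).2 fun v hv => ?_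
  have h1 : v = -(t • fderiv ℝ P z v) := eq_neg_of_add_eq_zero_left hv
  have h2 : ‖v‖ ≤ |t| * M * ‖v‖ := by
    calc ‖v‖ = |t| * ‖fderiv ℝ P z v‖ := by
          conv_lhs => rw [h1, norm_neg, norm_smul, Real.norm_eq_abs]
      _ ≤ |t| * (M * ‖v‖) := by
          gcongr
          exact (ContinuousLinearMap.le_opNorm _ _).trans
            (by gcongr; exact norm_fderiv_le_of_lipschitz ℝ hM)
      _ = |t| * M * ‖v‖ := by ring
  by_contra hne
  have := norm_pos_iff.2 hne
  nlinarith

omit hP in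
theorem norm_sub_le_pert {M : ℝ≥0} (hM : LipschitzWith M P) (t : ℝ) (z w : Fin 3 → ℂ) :
    (1 - |t| * M) * ‖z - w‖ ≤ ‖(z + t • P z) - (w + t • P w)‖ := by
  have h1 : ‖t • (P z - P w)‖ ≤ |t| * (M * ‖z - w‖) := by
    rw [norm_smul, Real.norm_eq_abs]
    gcongr
    simpa [dist_eq_norm] using hM.dist_le_mul z w
  have h2 : (z + t • P z) - (w + t • P w) = (z - w) + t • (P z - P w) := by
    rw [smul_sub]; abel
  rw [h2]
  have := norm_sub_le ((z - w) + t • (P z - P w)) (t • (P z - P w))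
  rw [add_sub_cancel_right] at this
  linarith

omit hP in
theorem injective_pert {M : ℝ≥0} (hM : LipschitzWith M P) {t : ℝ} (ht : |t| * M < 1) :
    Function.Injective fun z => z + t • P z := by
  intro z w h
  have h1 := norm_sub_le_pert hM t z w
  rw [sub_eq_zero.2 h, norm_zero] at h1
  by_contra hne
  have := norm_pos_iff.2 (sub_ne_zero.2 hne)
  nlinarith

/-- A scalar relating two images can be absorbed into a representative by homogeneity, which reduces
to injectivity on `ℂ³`. -/
theorem injective_pertMap {M : ℝ≥0} (hM : LipschitzWith M P) {t : ℝ} (ht : |t| * M < 1) :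
    Function.Injective (pertMap P t) := by
  intro p q h
  rw [pertMap, pertMap, proj_eq_proj_iff (hP.ne_zero _ _ p.rep_nonzero)
    (hP.ne_zero _ _ q.rep_nonzero)] at h
  obtain ⟨c, hc, h⟩ := h
  have h1 : p.rep = c • q.rep := by
    refine injective_pert hM ht ?_
    simp only [h, hP.hom, smul_add, smul_comm t c]
  rw [← proj_rep p, h1, proj_smul q.rep_nonzero hc, proj_rep]

theorem continuous_pertMap (t : ℝ) : Continuous (pertMap P t) := by
  rw [continuous_iff_proj]
  intro z hz
  have h1 : ContinuousAt (fun z => proj (z + t • P z)) z :=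
    (continuousAt_proj (hP.ne_zero t z hz)).comp
      (f := fun z => z + t • P z) (hP.contDiffAt_pert t hz).continuousAt
  refine (h1.congr ?_).continuousWithinAt
  filter_upwards [isOpen_compl_singleton.mem_nhds hz] with w hw
  exact (hP.pertMap_proj t hw).symm

theorem isEmbedding_pertMap {M : ℝ≥0} (hM : LipschitzWith M P) {t : ℝ} (ht : |t| * M < 1) :
    IsEmbedding (pertMap P t) :=
  ((hP.continuous_pertMap t).isClosedEmbedding (hP.injective_pertMap hM ht)).isEmbedding

/-- The differential of `z + t P z` is injective and carries the line of `z` onto the line of its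
image, so it carries nonradial vectors to nonradial vectors. -/
theorem immersiveAt_pertMap {E : Type*} [NormedAddCommGroup E] [NormedSpace ℝ E] {f : E → CP2}
    {x : E} {M : ℝ≥0} (hM : LipschitzWith M P) {t : ℝ} (ht : |t| * M < 1) (hf : SmoothAt f x)
    (hi : ImmersiveAt f x) : ImmersiveAt (fun y => pertMap P t (f y)) x := by
  obtain ⟨z, hz, h0, h⟩ := hf.exists_lift
  have hd : HasFDerivAt (fun y => z y + t • P (z y)) _ x :=
    (hP.hasFDerivAt_pert t h0).comp x (hz.differentiableAt (by simp)).hasFDerivAt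
  rw [immersiveAt_iff_of_lift hz h0 h] at hi
  refine (immersiveAt_iff_of_lift (z := fun y => z y + t • P (z y))
    ((hP.contDiffAt_pert t h0).comp x hz) (hP.ne_zero t _ h0) ?_).2 fun v c hv => hi v c ?_
  · filter_upwards [h, hz.continuousAt.eventually_ne h0] with y h1 h2
    rw [h1, hP.pertMap_proj _ h2]
  · rw [hd.fderiv] at hv
    refine injective_pert_deriv hM ht (z x) (hv.trans ?_)
    simp [hP.fderiv_apply_smul_self h0, smul_comm t c]

/-- The restriction of `pertMap P t` to a surface. -/
def smoothMap (t : ℝ) (S : Set CP2) : SmoothMap S where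
  toFun p := pertMap P t p
  smooth γ x hx := hP.smoothAt_pertMap (γ.smooth x hx) contDiffAt_const

theorem isSmoothEmbedding_smoothMap {M : ℝ≥0} (hM : LipschitzWith M P) {t : ℝ}
    (ht : |t| * M < 1) (S : Set CP2) : (hP.smoothMap t S).IsSmoothEmbedding :=
  ⟨(hP.isEmbedding_pertMap hM ht).comp IsEmbedding.subtypeVal, fun γ x hx =>
    hP.immersiveAt_pertMap hM ht (γ.smooth x hx) (γ.immersive x hx)⟩

end IsHomPerturbation

end CP2

namespace CP2

/-! ### Convergence to the inclusion in the `C^∞` topology -/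

section Slices

variable {E F : Type*} [NormedAddCommGroup E] [NormedSpace ℝ E] [NormedAddCommGroup F]
  [NormedSpace ℝ F]

theorem iteratedFDeriv_slice {Φ : ℝ × E → F} {u : Set (ℝ × E)} (hu : IsOpen u) {n : ℕ}
    (hΦ : ContDiffOn ℝ n Φ u) {t : ℝ} {y : E} (hy : (t, y) ∈ u) :
    iteratedFDeriv ℝ n (fun z => Φ (t, z)) y =
      (iteratedFDeriv ℝ n Φ (t, y)).compContinuousLinearMap
        fun _ => ContinuousLinearMap.inr ℝ ℝ E := by
  set Φt : ℝ × E → F := fun w => Φ ((t, 0) + w) with hΦt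
  set v : Set (ℝ × E) := (fun w => (t, 0) + w) ⁻¹' u with hv
  have hvo : IsOpen v := hu.preimage (by fun_prop)
  have hcd : ContDiffOn ℝ n Φt v :=
    hΦ.comp (contDiff_const.add contDiff_id).contDiffOn fun w hw => hw
  have hyv : ContinuousLinearMap.inr ℝ ℝ E y ∈ v := by simpa [hv] using hy
  have hvo' : IsOpen ((ContinuousLinearMap.inr ℝ ℝ E) ⁻¹' v) :=
    hvo.preimage (ContinuousLinearMap.continuous _)
  have h := (ContinuousLinearMap.inr ℝ ℝ E).iteratedFDerivWithin_comp_right hcd hvo.uniqueDiffOn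
    hvo'.uniqueDiffOn hyv le_rfl
  rw [iteratedFDerivWithin_of_isOpen n hvo' hyv, iteratedFDerivWithin_of_isOpen n hvo hyv, hΦt,
    iteratedFDeriv_comp_add_left'] at h
  have h1 : (fun w => Φ ((t, 0) + w)) ∘ ContinuousLinearMap.inr ℝ ℝ E = fun z => Φ (t, z) := by
    ext z; simp
  rw [h1] at h
  simpa using h

/-- The derivatives in the second variable alone are restrictions of the full derivatives of `Φ`.
Joint continuity in the parameter is what makes convergence uniform on compact sets. -/
theorem continuousAt_iteratedFDeriv_slice {Φ : ℝ × E → F} {t : ℝ} {x : E}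
    (hΦ : ContDiffAt ℝ ∞ Φ (t, x)) (n : ℕ) :
    ContinuousAt (fun w : ℝ × E => iteratedFDeriv ℝ n (fun z => Φ (w.1, z)) w.2) (t, x) := by
  obtain ⟨u, hu, hxu, hcd⟩ := ContDiffWithinAt.contDiffOn' (m := (n : WithTop ℕ∞)) (by
    exact_mod_cast le_top) (by simp) (contDiffWithinAt_univ.2 hΦ)
  rw [insert_eq_of_mem (mem_univ _), univ_inter] at hcd
  have h1 : ContinuousAt (fun w : ℝ × E => (iteratedFDeriv ℝ n Φ w).compContinuousLinearMap
      fun _ => ContinuousLinearMap.inr ℝ ℝ E) (t, x) := by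
    refine (map_continuous (ContinuousMultilinearMap.compContinuousLinearMapL (𝕜 := ℝ)
      (F := F) fun _ : Fin n => ContinuousLinearMap.inr ℝ ℝ E)).continuousAt.comp
      (f := iteratedFDeriv ℝ n Φ) ?_
    exact hΦ.continuousAt_iteratedFDeriv (by exact_mod_cast le_top)
  refine h1.congr ?_
  filter_upwards [hu.mem_nhds hxu] with w hw
  exact (iteratedFDeriv_slice hu hcd hw).symm

theorem SmoothAt.comp {f : F → CP2} {g : E → F} {x : E} (hf : SmoothAt f (g x))
    (hg : ContDiffAt ℝ ∞ g x) : SmoothAt (fun y => f (g y)) x := by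
  obtain ⟨z, hz, h0, h⟩ := hf.exists_lift
  exact smoothAt_of_lift (hz.comp x hg) h0 (hg.continuousAt.eventually h)

end Slices

/-- The map is smooth jointly in `t` and the point, so each subbasic condition is open in `(t, x)`;
compactness of `K` gives one range of `t` valid for all `x`. The subbasic set need only contain the
inclusion, not be centred at it. -/
theorem IsHomPerturbation.tendsto_smoothMap {P : (Fin 3 → ℂ) → Fin 3 → ℂ}
    (hP : IsHomPerturbation P) (S : Set CP2) :
    Tendsto (fun t => hP.smoothMap t S) (𝓝 0) (𝓝 (SmoothMap.incl S)) := by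
  refine TopologicalSpace.tendsto_nhds_generateFrom_iff.2 ?_
  rintro _ ⟨f, γ, a, K, r, ε, hK, hKγ, hKa, hε, rfl⟩ hincl
  have h0 : ∀ p : CP2, pertMap P 0 p = p := fun p => by simp [pertMap, proj_rep]
  refine hK.eventually_forall_of_forall_eventually fun x hx => ?_
  have hγ := γ.smooth x (hKγ hx)
  have hsm : SmoothAt (fun w : ℝ × ℂ => pertMap P w.1 (γ.toFun w.2)) (0, x) :=
    hP.smoothAt_pertMap (SmoothAt.comp (f := fun z => (γ.toFun z : CP2))
      (g := fun w : ℝ × ℂ => w.2) hγ contDiffAt_snd)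
      contDiffAt_fst
  have hmem : pertMap P 0 (γ.toFun x) ∈ affineOpen a := by
    rw [h0]; exact (hincl x hx).1
  have hcf : ContDiffAt ℝ ∞ (fun z => chart a (f.toFun (γ.toFun z))) x :=
    f.smooth γ x (hKγ hx) a (hKa x hx)
  have hd : ∀ j ∈ Finset.range (r + 1), ∀ᶠ w : ℝ × ℂ in 𝓝 (0, x),
      ‖iteratedFDeriv ℝ j (fun z => chart a (pertMap P w.1 (γ.toFun z))) w.2 -
        iteratedFDeriv ℝ j (fun z => chart a (f.toFun (γ.toFun z))) w.2‖ < ε := by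
    intro j hj
    have h1 := continuousAt_iteratedFDeriv_slice (hsm a hmem) j
    have h2 : ContinuousAt (fun w : ℝ × ℂ =>
        iteratedFDeriv ℝ j (fun z => chart a (f.toFun (γ.toFun z))) w.2) (0, x) :=
      ContinuousAt.comp (g := iteratedFDeriv ℝ j (fun z => chart a (f.toFun (γ.toFun z))))
        (f := Prod.snd) (hcf.continuousAt_iteratedFDeriv (by exact_mod_cast le_top))
        continuousAt_snd
    refine (h1.sub h2).norm.eventually_lt continuousAt_const ?_
    simp only [Pi.sub_apply, h0]
    exact (hincl x hx).2 j (Nat.lt_succ_iff.1 (Finset.mem_range.1 hj))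
  filter_upwards [hsm.eventually_mem hmem, (Finset.eventually_all (Finset.range (r + 1))).2 hd]
    with w h1 h2
  exact ⟨h1, fun j hj => h2 j (Finset.mem_range.2 (Nat.lt_succ_of_le hj))⟩

end CP2

namespace CP2

open scoped NNReal
open MvPolynomial

/-! ### The perturbed surfaces are symplectic -/

/-- The numerator of the Fubini–Study form. -/
def fsNum (z u w : Fin 3 → ℂ) : ℝ :=
  ((z ⬝ᵥ star z) * (u ⬝ᵥ star w) - (u ⬝ᵥ star z) * (z ⬝ᵥ star w)).im

theorem dotProduct_star_self_eq (z : Fin 3 → ℂ) :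
    z ⬝ᵥ star z = ((∑ i, Complex.normSq (z i) : ℝ) : ℂ) := by
  simp [dotProduct, Complex.mul_conj]

theorem sum_normSq_pos {z : Fin 3 → ℂ} (hz : z ≠ 0) : 0 < ∑ i, Complex.normSq (z i) := by
  obtain ⟨i, hi⟩ := Function.ne_iff.1 hz
  exact Finset.sum_pos' (fun _ _ => Complex.normSq_nonneg _)
    ⟨i, Finset.mem_univ i, Complex.normSq_pos.2 hi⟩

theorem dotProduct_star_self_ne_zero {z : Fin 3 → ℂ} (hz : z ≠ 0) : z ⬝ᵥ star z ≠ 0 := by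
  rw [dotProduct_star_self_eq]
  exact_mod_cast (sum_normSq_pos hz).ne'

theorem fubiniStudy_ne_zero_iff {z : Fin 3 → ℂ} (hz : z ≠ 0) (u w : Fin 3 → ℂ) :
    fubiniStudy z u w ≠ 0 ↔ fsNum z u w ≠ 0 := by
  rw [fubiniStudy, fsNum]
  nth_rewrite 2 [dotProduct_star_self_eq z]
  rw [← Complex.ofReal_pow, Complex.div_ofReal_im, neg_ne_zero, div_ne_zero_iff]
  exact and_iff_left (pow_ne_zero _ (sum_normSq_pos hz).ne')

/-- Radial directions lie in the kernel, as the form is pulled back from `CP²`; tangent vectors may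
be computed with any lift. -/
theorem fsNum_add_smul (z u w : Fin 3 → ℂ) (α β : ℂ) :
    fsNum z (u + α • z) (w + β • z) = fsNum z u w := by
  unfold fsNum
  congr 1
  simp only [star_add, star_smul, add_dotProduct, dotProduct_add, smul_dotProduct, dotProduct_smul,
    smul_eq_mul]
  ring

theorem fsNum_smul (z u w : Fin 3 → ℂ) (r s : ℝ) :
    fsNum (r • z) (s • u) (s • w) = r ^ 2 * s ^ 2 * fsNum z u w := by
  unfold fsNum
  rw [← Complex.im_ofReal_mul]
  congr 1
  simp only [star_smul, smul_dotProduct, dotProduct_smul, Complex.real_smul, star_trivial]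
  push_cast
  ring

theorem continuous_fsNum :
    Continuous fun x : (Fin 3 → ℂ) × (Fin 3 → ℂ) × (Fin 3 → ℂ) => fsNum x.1 x.2.1 x.2.2 := by
  unfold fsNum
  simp only [dotProduct, Fin.sum_univ_three, Pi.star_apply]
  fun_prop

/-- For `β` orthogonal to `z` the value is `-|z|²|β|²`: complex lines are symplectic. -/
theorem fsNum_I_smul {z β : Fin 3 → ℂ} (hz : z ≠ 0) (hβ : β ≠ 0) (h : β ⬝ᵥ star z = 0) :
    fsNum z β (Complex.I • β) ≠ 0 := by
  rw [fsNum, h, star_smul, dotProduct_smul, dotProduct_star_self_eq, dotProduct_star_self_eq]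
  simp only [zero_mul, sub_zero, smul_eq_mul]
  rw [Complex.im_ofReal_mul, Complex.im_mul_ofReal]
  exact mul_ne_zero (sum_normSq_pos hz).ne'
    (mul_ne_zero (by simp) (sum_normSq_pos hβ).ne')

namespace IsHomPerturbation

variable {P : (Fin 3 → ℂ) → Fin 3 → ℂ} (hP : IsHomPerturbation P)
include hP

theorem eventually_fsNum_ne_zero_of_norm_eq_one :
    ∀ᶠ t : ℝ in 𝓝 0, ∀ x : (Fin 3 → ℂ) × (Fin 3 → ℂ), x ∈ {x : (Fin 3 → ℂ) × (Fin 3 → ℂ) |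
      ‖x.1‖ = 1 ∧ ‖x.2‖ = 1 ∧ x.2 ⬝ᵥ star x.1 = 0} →
      fsNum (x.1 + t • P x.1) (x.2 + t • fderiv ℝ P x.1 x.2)
        (Complex.I • x.2 + t • fderiv ℝ P x.1 (Complex.I • x.2)) ≠ 0 := by
  have hK : IsCompact {x : (Fin 3 → ℂ) × (Fin 3 → ℂ) |
      ‖x.1‖ = 1 ∧ ‖x.2‖ = 1 ∧ x.2 ⬝ᵥ star x.1 = 0} := by
    refine ((isCompact_sphere (0 : Fin 3 → ℂ) 1).prod
      (isCompact_sphere (0 : Fin 3 → ℂ) 1)).of_isClosed_subset ?_ ?_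
    · refine (isClosed_eq (by fun_prop) continuous_const).inter
        ((isClosed_eq (by fun_prop) continuous_const).inter (isClosed_eq ?_ continuous_const))
      simp only [dotProduct, Fin.sum_univ_three, Pi.star_apply]
      fun_prop
    · rintro x ⟨h1, h2, -⟩
      exact ⟨by simpa using h1, by simpa using h2⟩
  refine hK.eventually_forall_of_forall_eventually (x₀ := (0 : ℝ)) ?_
  rintro ⟨z, β⟩ ⟨h1, h2, h3⟩
  have hz : z ≠ 0 := by rintro rfl; simp at h1
  have hβ : β ≠ 0 := by rintro rfl; simp at h2
  have hc1 : ContinuousAt (fun y : ℝ × (Fin 3 → ℂ) × (Fin 3 → ℂ) => P y.2.1) (0, z, β) :=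
    ContinuousAt.comp (g := P) (f := fun y : ℝ × (Fin 3 → ℂ) × (Fin 3 → ℂ) => y.2.1)
      (hP.smooth z hz).continuousAt (by fun_prop)
  have hc2 : ContinuousAt (fun y : ℝ × (Fin 3 → ℂ) × (Fin 3 → ℂ) => fderiv ℝ P y.2.1)
      (0, z, β) :=
    ContinuousAt.comp (g := fderiv ℝ P) (f := fun y : ℝ × (Fin 3 → ℂ) × (Fin 3 → ℂ) => y.2.1)
      ((hP.smooth z hz).continuousAt_fderiv (by simp)) (by fun_prop)
  have hc : ContinuousAt (fun y : ℝ × (Fin 3 → ℂ) × (Fin 3 → ℂ) =>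
      fsNum (y.2.1 + y.1 • P y.2.1) (y.2.2 + y.1 • fderiv ℝ P y.2.1 y.2.2)
        (Complex.I • y.2.2 + y.1 • fderiv ℝ P y.2.1 (Complex.I • y.2.2))) (0, z, β) := by
    refine ContinuousAt.comp (f := fun y : ℝ × (Fin 3 → ℂ) × (Fin 3 → ℂ) =>
      (y.2.1 + y.1 • P y.2.1, y.2.2 + y.1 • fderiv ℝ P y.2.1 y.2.2,
        Complex.I • y.2.2 + y.1 • fderiv ℝ P y.2.1 (Complex.I • y.2.2)))
      continuous_fsNum.continuousAt ?_
    have hs : ContinuousAt (fun y : ℝ × (Fin 3 → ℂ) × (Fin 3 → ℂ) => y.2.2) (0, z, β) := by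
      fun_prop
    have hs' : ContinuousAt (fun y : ℝ × (Fin 3 → ℂ) × (Fin 3 → ℂ) => Complex.I • y.2.2)
        (0, z, β) := by fun_prop
    have hf : ContinuousAt (fun y : ℝ × (Fin 3 → ℂ) × (Fin 3 → ℂ) => y.2.1) (0, z, β) := by
      fun_prop
    exact (hf.add (continuousAt_fst.smul hc1)).prodMk ((hs.add (continuousAt_fst.smul
      (hc2.clm_apply hs))).prodMk (hs'.add (continuousAt_fst.smul (hc2.clm_apply hs'))))
  refine hc.eventually_ne ?_
  simpa using fsNum_I_smul hz hβ h3

/-- Removing the component of `β` along `z` and rescaling `z` and `β` separately reduces to the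
compact set of unit pairs with vanishing Hermitian product, where one `t` works uniformly. -/
theorem eventually_fsNum_ne_zero :
    ∀ᶠ t : ℝ in 𝓝 0, ∀ z β : Fin 3 → ℂ, z ≠ 0 → (∀ c : ℂ, β ≠ c • z) →
      fsNum (z + t • P z) (β + t • fderiv ℝ P z β)
        (Complex.I • β + t • fderiv ℝ P z (Complex.I • β)) ≠ 0 := by
  filter_upwards [hP.eventually_fsNum_ne_zero_of_norm_eq_one] with t ht z β hz hβ
  set α : ℂ := (β ⬝ᵥ star z) / (z ⬝ᵥ star z) with hα
  set β' := β - α • z with hβ'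
  have hβ0 : β' ≠ 0 := sub_ne_zero.2 (hβ α)
  have horth : β' ⬝ᵥ star z = 0 := by
    rw [hβ', sub_dotProduct, smul_dotProduct, smul_eq_mul, hα,
      div_mul_cancel₀ _ (dotProduct_star_self_ne_zero hz), sub_self]
  set r : ℝ := ‖z‖⁻¹ with hr
  set s : ℝ := ‖β'‖⁻¹ with hs
  have hr0 : r ≠ 0 := inv_ne_zero (norm_ne_zero_iff.2 hz)
  have hs0 : s ≠ 0 := inv_ne_zero (norm_ne_zero_iff.2 hβ0)
  have h1 := ht (r • z, s • β') ⟨?_, ?_, ?_⟩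
  · have e1 : r • z + t • P (r • z) = r • (z + t • P z) := by
      rw [hP.real_hom, smul_add, smul_comm t r]
    have e2 : s • β' + t • fderiv ℝ P (r • z) (s • β') = s • (β' + t • fderiv ℝ P z β') := by
      rw [hP.fderiv_smul hz hr0, map_smul, smul_add, smul_comm t s]
    have e3 : Complex.I • s • β' + t • fderiv ℝ P (r • z) (Complex.I • s • β') =
        s • (Complex.I • β' + t • fderiv ℝ P z (Complex.I • β')) := by
      rw [hP.fderiv_smul hz hr0, smul_comm Complex.I s, map_smul, smul_add, smul_comm t s]
    rw [e1, e2, e3, fsNum_smul] at h1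
    have h2 := right_ne_zero_of_mul h1
    have hβe : β = β' + α • z := by rw [hβ']; abel
    have e4 : β + t • fderiv ℝ P z β = (β' + t • fderiv ℝ P z β') + α • (z + t • P z) := by
      conv_lhs => rw [hβe, map_add, hP.fderiv_apply_smul_self hz]
      rw [smul_add, smul_add, smul_comm t α]; abel
    have e5 : Complex.I • β + t • fderiv ℝ P z (Complex.I • β) =
        (Complex.I • β' + t • fderiv ℝ P z (Complex.I • β')) +
          (Complex.I * α) • (z + t • P z) := by
      conv_lhs => rw [hβe, smul_add, smul_smul, map_add, hP.fderiv_apply_smul_self hz]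
      rw [smul_add, smul_add, smul_comm t (Complex.I * α)]; abel
    rwa [e4, e5, fsNum_add_smul]
  · simp [hr, norm_smul, hz]
  · simp [hs, norm_smul, hβ0]
  · simp [horth]

end IsHomPerturbation

theorem eventually_proj_mem_regLocus {F : MvPolynomial (Fin 3) ℂ} {k : ℕ}
    (hF : F.IsHomogeneous k) {X : Type*} [TopologicalSpace X] {z : X → Fin 3 → ℂ} {x : X}
    (hz : ContinuousAt z x)
    (h0 : z x ≠ 0) (h : ∀ᶠ t in 𝓝 x, eval (z t) F = 0) (hreg : ∃ i, eval (z x) (pderiv i F) ≠ 0) :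
    ∀ᶠ t in 𝓝 x, proj (z t) ∈ regLocus F := by
  obtain ⟨i, hi⟩ := hreg
  have hc : ContinuousAt (fun t => eval (z t) (pderiv i F)) x :=
    ((contDiff_eval (pderiv i F)).continuous.continuousAt).comp hz
  filter_upwards [h, hz.eventually_ne h0, hc.eventually_ne hi] with t h1 h2 h3
  exact (proj_mem_regLocus hF h2).2 ⟨h1, i, h3⟩

namespace IsHomPerturbation

variable {P : (Fin 3 → ℂ) → Fin 3 → ℂ} (hP : IsHomPerturbation P)
include hP

theorem exists_preimage_of_proj_mem_range {F : MvPolynomial (Fin 3) ℂ} {k : ℕ}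
    (hF : F.IsHomogeneous k) {t : ℝ} {z : Fin 3 → ℂ} (hz : z ≠ 0)
    (h : proj z ∈ range (hP.smoothMap t (regLocus F)).toFun) :
    ∃ b, b ≠ 0 ∧ b + t • P b = z ∧ eval b F = 0 ∧ ∃ i, eval b (pderiv i F) ≠ 0 := by
  obtain ⟨⟨p, hp⟩, h⟩ := h
  change proj _ = proj z at h
  obtain ⟨c, hc, h⟩ := (proj_eq_proj_iff hz (hP.ne_zero t _ p.rep_nonzero)).1 h.symm
  have hb : c • p.rep ≠ 0 := smul_ne_zero hc p.rep_nonzero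
  refine ⟨c • p.rep, hb, ?_, ?_⟩
  · rw [h, hP.hom, smul_add, smul_comm t c]
  · rwa [← proj_mem_regLocus hF hb, proj_smul p.rep_nonzero hc, proj_rep]

theorem proj_pert_mem_range {F : MvPolynomial (Fin 3) ℂ} (t : ℝ) {z : Fin 3 → ℂ} (hz : z ≠ 0)
    (h : proj z ∈ regLocus F) :
    proj (z + t • P z) ∈ range (hP.smoothMap t (regLocus F)).toFun :=
  ⟨⟨proj z, h⟩, hP.pertMap_proj t hz⟩

theorem exists_strict_deriv {M : ℝ≥0} (hM : LipschitzWith M P) {t : ℝ} (ht : |t| * M < 1)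
    {z : Fin 3 → ℂ} (hz : z ≠ 0) : ∃ e : (Fin 3 → ℂ) ≃L[ℝ] (Fin 3 → ℂ),
      (∀ v, e v = v + t • fderiv ℝ P z v) ∧
      HasStrictFDerivAt (fun z => z + t • P z) (e : (Fin 3 → ℂ) →L[ℝ] Fin 3 → ℂ) z := by
  have hinj := injective_pert_deriv hM ht z
  refine ⟨(LinearEquiv.ofInjectiveEndo _ hinj).toContinuousLinearEquiv, fun v => rfl, ?_⟩
  exact (hP.contDiffAt_pert t hz).hasStrictFDerivAt' (hP.hasFDerivAt_pert t hz) (by simp)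

/-- Pull a tangent vector `u` of the perturbed surface back to a vector `β` tangent to the cone `F =
0`. Since `ker dF` is complex, `i β` is tangent too, and its image pairs nontrivially with `u` for
small `t`. -/
theorem eventually_isSymplectic {F : MvPolynomial (Fin 3) ℂ} {k : ℕ} (hF : F.IsHomogeneous k)
    {M : ℝ≥0} (hM : LipschitzWith M P) :
    ∀ᶠ t : ℝ in 𝓝 0, |t| * M < 1 → IsSymplectic (range (hP.smoothMap t (regLocus F)).toFun) := by
  filter_upwards [hP.eventually_fsNum_ne_zero] with t hfs ht q hq a ha u hu hu0
  obtain ⟨hua, c, hc, hc0, hcu, hcS⟩ := exists_lift_of_mem_tangentVectors ha hu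
  have hex : ∀ τ, ∃ b, (c τ ≠ 0 ∧ proj (c τ) ∈ range (hP.smoothMap t (regLocus F)).toFun) →
      b ≠ 0 ∧ b + t • P b = c τ ∧ eval b F = 0 ∧ ∃ i, eval b (pderiv i F) ≠ 0 := by
    intro τ
    by_cases h : c τ ≠ 0 ∧ proj (c τ) ∈ range (hP.smoothMap t (regLocus F)).toFun
    · obtain ⟨b, hb⟩ := hP.exists_preimage_of_proj_mem_range hF h.1 h.2
      exact ⟨b, fun _ => hb⟩
    · exact ⟨0, fun h' => absurd h' h⟩
  choose b hb using hex
  have hb' : ∀ᶠ τ in 𝓝 0, b τ ≠ 0 ∧ b τ + t • P (b τ) = c τ ∧ eval (b τ) F = 0 ∧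
      ∃ i, eval (b τ) (pderiv i F) ≠ 0 := hcS.mono hb
  obtain ⟨hb0, hbc, hbF, hbreg⟩ := hb'.self_of_nhds
  -- The lifts `b τ` were chosen pointwise. The lower Lipschitz bound of `z + t P z` makes them
  -- continuous at `0`, and agreement with the local inverse then makes them differentiable there.
  have hcont : Tendsto b (𝓝 0) (𝓝 (b 0)) := by
    rw [tendsto_iff_norm_sub_tendsto_zero]
    have h1 : Tendsto (fun τ => (1 - |t| * M)⁻¹ * ‖c τ - c 0‖) (𝓝 0) (𝓝 0) := by
      have := (tendsto_iff_norm_sub_tendsto_zero.1 hc.continuousAt.tendsto).const_mul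
        (1 - |t| * M)⁻¹
      simpa using this
    refine squeeze_zero' (Eventually.of_forall fun _ => norm_nonneg _) ?_ h1
    filter_upwards [hb'] with τ hτ
    rw [le_inv_mul_iff₀ (by linarith), ← hbc, ← hτ.2.1]
    exact norm_sub_le_pert hM t _ _
  obtain ⟨e, he, hs⟩ := hP.exists_strict_deriv hM ht hb0
  have hbe : b =ᶠ[𝓝 0] fun τ => hs.localInverse _ _ _ (c τ) := by
    filter_upwards [hcont.eventually hs.eventually_left_inverse, hb'] with τ h1 h2
    rw [← h2.2.1, h1]
  have hbd : HasDerivAt b (e.symm u) 0 := by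
    have h1 := hs.to_localInverse.hasFDerivAt
    simp only [hbc] at h1
    exact (h1.comp_hasDerivAt (0 : ℝ) hcu).congr_of_eventuallyEq hbe
  set β := e.symm u with hβ
  have hAβ : β + t • fderiv ℝ P (b 0) β = u := by rw [← he, hβ, e.apply_symm_apply]
  have hkerβ : evalDeriv F (b 0) β = 0 := by
    have h1 : HasDerivAt (fun τ => eval (b τ) F) (evalDeriv F (b 0) β) 0 :=
      (hasFDerivAt_real_eval F (b 0)).comp_hasDerivAt (0 : ℝ) hbd
    exact h1.unique ((hasDerivAt_const (0 : ℝ) (0 : ℂ)).congr_of_eventuallyEq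
      (hb'.mono fun τ h => h.2.2.1))
  have hc0a : c 0 a = 1 := by rw [hc0, chart_self ha]
  have hc00 : c 0 ≠ 0 := fun h => by simp [h] at hc0a
  -- If `β` were radial, so would be `u`; but `u a = 0` while `c 0 a = 1`, which would force `u =
  -- 0`.
  have hβb : ∀ ν : ℂ, β ≠ ν • b 0 := by
    intro ν hν
    apply hu0
    have h1 : u = ν • c 0 := by
      rw [← hAβ, hν, hP.fderiv_apply_smul_self hb0, ← hbc, smul_add, smul_comm t ν]
    have h2 : ν = 0 := by
      have := congrFun h1 a
      simpa [hua, hc0a] using this.symm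
    rw [h1, h2, zero_smul]
  obtain ⟨z, hz, hz0, hzd, hzF⟩ := exists_curve_of_evalDeriv_eq_zero hbF hbreg
    (v := Complex.I • β) (by rw [map_smul, hkerβ, smul_zero])
  have hbz : z 0 ≠ 0 := by rwa [hz0]
  have hlift : HasDerivAt (fun τ => z τ + t • P (z τ))
      (Complex.I • β + t • fderiv ℝ P (b 0) (Complex.I • β)) 0 := by
    have h1 := (hP.hasFDerivAt_pert t hbz).comp_hasDerivAt (0 : ℝ) hzd
    rw [hz0] at h1
    exact h1
  have hbc' : z 0 + t • P (z 0) = c 0 := by rw [hz0, hbc]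
  have hmem := normDeriv_mem_tangentVectors (z := fun τ => z τ + t • P (z τ)) (a := a)
    (S := range (hP.smoothMap t (regLocus F)).toFun)
    ((hP.contDiffAt_pert t hbz).comp (0 : ℝ) hz) (by
      rw [hbc', hc0a]; exact one_ne_zero) hlift (by
      filter_upwards [eventually_proj_mem_regLocus hF hz.continuousAt hbz hzF (by rwa [hz0]),
        hz.continuousAt.eventually_ne hbz] with τ h1 h2
      exact hP.proj_pert_mem_range t h2 h1)
  simp only [hbc'] at hmem
  rw [hc0, proj_chart ha, ← hc0] at hmem
  refine ⟨_, hmem, ?_⟩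
  rw [← hc0, fubiniStudy_ne_zero_iff hc00, normDeriv, hc0a]
  have h1 := hfs (b 0) β hb0 hβb
  rw [hAβ, hbc, ← fsNum_add_smul _ _ _ 0 (-((1 : ℂ)⁻¹ ^ 2 *
    (Complex.I • β + t • fderiv ℝ P (b 0) (Complex.I • β)) a))] at h1
  rw [inv_one, one_smul, sub_eq_add_neg, ← neg_smul]
  simpa using h1

end IsHomPerturbation

end CP2

namespace CP2

open MvPolynomial MeasureTheory
open scoped NNReal

/-! ### Local parametrizations of the regular locus -/

/-- Otherwise Euler's relation reads `z_c ∂F/∂z_c = k F = 0` with both factors nonzero. -/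
theorem exists_ne_coord_ne_zero {F : MvPolynomial (Fin 3) ℂ} {k : ℕ} (hF : F.IsHomogeneous k)
    {z : Fin 3 → ℂ} (hz : z ≠ 0) (h0 : eval z F = 0) {c : Fin 3}
    (hc : eval z (pderiv c F) ≠ 0) : ∃ a, a ≠ c ∧ z a ≠ 0 := by
  by_contra! h
  have h1 := congrArg (eval z) (hF.sum_X_mul_pderiv)
  have hzc : z c ≠ 0 := fun h2 => hz (funext fun i => by
    by_cases hi : i = c
    · rw [hi]; exact h2
    · exact h i hi)
  rw [map_sum, Finset.sum_eq_single c (fun i _ hi => by simp [h i hi]) (by simp)] at h1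
  simp [h0, hzc, hc] at h1

/-- Rescaling a nearby point of the cone so that its coordinate `a` matches that of `z` puts it on
the graph given by `exists_local_param`. The patch thus covers a neighbourhood in the cone up to
scalars. -/
theorem exists_param_regLocus {F : MvPolynomial (Fin 3) ℂ} {k : ℕ}
    (hF : F.IsHomogeneous k) {z : Fin 3 → ℂ} (hz : z ≠ 0) (h0 : eval z F = 0)
    (hreg : ∃ i, eval z (pderiv i F) ≠ 0) :
    ∃ (σ : ℂ → Fin 3 → ℂ) (B : Set ℂ), IsOpen B ∧
      (∀ x ∈ B, ContDiffAt ℝ ∞ σ x ∧ σ x ≠ 0 ∧ proj (σ x) ∈ regLocus F) ∧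
      ∀ᶠ w in 𝓝 z, eval w F = 0 → ∃ x ∈ B, ∃ c : ℂ, c ≠ 0 ∧ w = c • σ x := by
  obtain ⟨c, hc⟩ := hreg
  obtain ⟨a, hac, ha⟩ := exists_ne_coord_ne_zero hF hz h0 hc
  obtain ⟨b, hba, hbc⟩ : ∃ b, b ≠ a ∧ b ≠ c := by clear * - hac; revert a c; decide
  have hthird : ∀ i, i ≠ b → i ≠ c → i = a := by clear * - hac hba hbc; revert a b c; decide
  obtain ⟨σ, hσ, hσz, h1, h2⟩ := exists_local_param hbc h0 hc
  have hreg : ∀ᶠ x in 𝓝 (z b), proj (σ x) ∈ regLocus F :=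
    eventually_proj_mem_regLocus hF hσ.continuousAt (by rwa [hσz]) (h1.mono fun x h => h.1)
      ⟨c, by rwa [hσz]⟩
  have hev := ((hσ.eventually (by simp)).and
    ((hσ.continuousAt.eventually_ne (by rwa [hσz])).and hreg))
  obtain ⟨B, hB, hBo, hzB⟩ := eventually_nhds_iff.1 hev
  refine ⟨σ, B, hBo, fun x hx => ⟨(hB x hx).1.of_le le_top, (hB x hx).2⟩, ?_⟩
  have hnorm : ContinuousAt (fun w : Fin 3 → ℂ => (z a * (w a)⁻¹) • w) z :=
    (continuousAt_const.mul ((continuous_apply a).continuousAt.inv₀ ha)).smul continuousAt_id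
  have hnz : (z a * (z a)⁻¹) • z = z := by rw [mul_inv_cancel₀ ha, one_smul]
  have ht : Tendsto (fun w : Fin 3 → ℂ => (z a * (w a)⁻¹) • w) (𝓝 z) (𝓝 z) := by
    have := hnorm.tendsto
    rwa [hnz] at this
  filter_upwards [ht.eventually h2, ((continuous_apply a).continuousAt (x := z)).eventually_ne ha,
    (((continuous_apply b).tendsto z).comp ht).eventually (hBo.mem_nhds hzB)]
    with w hw hwa hwB hFw
  refine ⟨_, hwB, (z a * (w a)⁻¹)⁻¹, inv_ne_zero (mul_ne_zero ha (inv_ne_zero hwa)), ?_⟩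
  have := hw (by rw [eval_smul_of_isHomogeneous hF, hFw, mul_zero]) (fun i hib hic => by
    rw [hthird i hib hic, Pi.smul_apply, smul_eq_mul, mul_assoc, inv_mul_cancel₀ hwa, mul_one])
  rw [Function.comp_apply, ← this, smul_smul,
    inv_mul_cancel₀ (mul_ne_zero ha (inv_ne_zero hwa)), one_smul]

/-! ### A family of plane curves and its generic members -/

/-- The monomials `z_i ^ (d - 1) * z_j`. -/
def famMono (d : ℕ) (i j : Fin 3) : MvPolynomial (Fin 3) ℂ := X i ^ (d - 1) * X j

/-- The family `G₀ + ∑ θ_ij z_i ^ (d - 1) z_j`. -/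
def fam (d : ℕ) (G₀ : MvPolynomial (Fin 3) ℂ) (θ : Fin 3 → Fin 3 → ℂ) :
    MvPolynomial (Fin 3) ℂ :=
  G₀ + ∑ i, ∑ j, C (θ i j) * famMono d i j

theorem isHomogeneous_fam {d : ℕ} (hd : 1 ≤ d) {G₀ : MvPolynomial (Fin 3) ℂ}
    (hG : G₀.IsHomogeneous d) (θ : Fin 3 → Fin 3 → ℂ) : (fam d G₀ θ).IsHomogeneous d := by
  refine hG.add (IsHomogeneous.sum _ _ _ fun i _ => IsHomogeneous.sum _ _ _ fun j _ =>
    IsHomogeneous.C_mul ?_ _)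
  have := (isHomogeneous_X_pow (R := ℂ) i (d - 1)).mul (isHomogeneous_X ℂ j)
  rwa [Nat.sub_add_cancel hd] at this

theorem eval_fam (d : ℕ) (G₀ : MvPolynomial (Fin 3) ℂ) (θ : Fin 3 → Fin 3 → ℂ)
    (z : Fin 3 → ℂ) :
    eval z (fam d G₀ θ) = eval z G₀ + ∑ i, ∑ j, θ i j * eval z (famMono d i j) := by
  simp [fam]

theorem eval_pderiv_fam (d : ℕ) (G₀ : MvPolynomial (Fin 3) ℂ) (θ : Fin 3 → Fin 3 → ℂ)
    (z : Fin 3 → ℂ) (c : Fin 3) :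
    eval z (pderiv c (fam d G₀ θ)) = eval z (pderiv c G₀) +
      ∑ i, ∑ j, θ i j * eval z (pderiv c (famMono d i j)) := by
  simp [fam]

/-- The case of Sard's theorem with source and target of equal dimension: differentiability is
enough, and a kernel vector makes the Jacobian vanish. -/
theorem addHaar_image_eq_zero_of_ker {E : Type*} [NormedAddCommGroup E] [NormedSpace ℝ E]
    [FiniteDimensional ℝ E] [MeasurableSpace E] [BorelSpace E] (μ : Measure E) [μ.IsAddHaarMeasure]
    {Ψ : E → E} {s : Set E}
    (h : ∀ θ ∈ s, DifferentiableAt ℝ Ψ θ ∧ ∃ v, v ≠ 0 ∧ fderiv ℝ Ψ θ v = 0) :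
    μ (Ψ '' s) = 0 := by
  refine addHaar_image_eq_zero_of_det_fderivWithin_eq_zero μ (f' := fderiv ℝ Ψ)
    (fun θ hθ => (h θ hθ).1.hasFDerivAt.hasFDerivWithinAt) fun θ hθ => ?_
  obtain ⟨v, hv0, hv⟩ := (h θ hθ).2
  by_contra hdet
  have := (LinearMap.equivOfDetNeZero (fderiv ℝ Ψ θ : E →ₗ[ℝ] E) hdet).injective
  exact hv0 (this (by simpa using hv))

section Null

variable (μ : Measure (Fin 3 → Fin 3 → ℂ)) [μ.IsAddHaarMeasure] (d : ℕ)
  (G₀ : MvPolynomial (Fin 3) ℂ)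

theorem differentiableAt_eval_fam {E : Type*} [NormedAddCommGroup E] [NormedSpace ℝ E]
    {w : E → Fin 3 → ℂ} {θ : E → Fin 3 → Fin 3 → ℂ} {x : E} (hw : DifferentiableAt ℝ w x)
    (hθ : DifferentiableAt ℝ θ x) :
    DifferentiableAt ℝ (fun y => eval (w y) (fam d G₀ (θ y))) x := by
  simp only [eval_fam]
  have h : ∀ G : MvPolynomial (Fin 3) ℂ, DifferentiableAt ℝ (fun y => eval (w y) G) x := fun G =>
    DifferentiableAt.comp (g := fun z => eval z G) x (hasFDerivAt_real_eval G _).differentiableAt hw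
  refine (h _).add (DifferentiableAt.fun_sum fun i _ => DifferentiableAt.fun_sum fun j _ => ?_)
  exact (differentiableAt_pi.1 (differentiableAt_pi.1 hθ i) j).mul (h _)

theorem differentiableAt_eval_pderiv_fam {E : Type*} [NormedAddCommGroup E] [NormedSpace ℝ E]
    {w : E → Fin 3 → ℂ} {θ : E → Fin 3 → Fin 3 → ℂ} {x : E} (c : Fin 3)
    (hw : DifferentiableAt ℝ w x) (hθ : DifferentiableAt ℝ θ x) :
    DifferentiableAt ℝ (fun y => eval (w y) (pderiv c (fam d G₀ (θ y)))) x := by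
  simp only [eval_pderiv_fam]
  have h : ∀ G : MvPolynomial (Fin 3) ℂ, DifferentiableAt ℝ (fun y => eval (w y) G) x := fun G =>
    DifferentiableAt.comp (g := fun z => eval z G) x (hasFDerivAt_real_eval G _).differentiableAt hw
  refine (h _).add (DifferentiableAt.fun_sum fun i _ => DifferentiableAt.fun_sum fun j _ => ?_)
  exact (differentiableAt_pi.1 (differentiableAt_pi.1 hθ i) j).mul (h _)

/-- Replace the entry `(a, a)` of `θ`. -/
def setDiag (a : Fin 3) (θ : Fin 3 → Fin 3 → ℂ) (x : ℂ) : Fin 3 → Fin 3 → ℂ :=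
  Function.update θ a (Function.update (θ a) a x)

theorem setDiag_apply (a : Fin 3) (θ : Fin 3 → Fin 3 → ℂ) (x : ℂ) (i j : Fin 3) :
    setDiag a θ x i j = if i = a ∧ j = a then x else θ i j := by
  by_cases hi : i = a
  · subst hi
    by_cases hj : j = i
    · subst hj; simp [setDiag]
    · simp [setDiag, hj]
  · simp [setDiag, hi]

theorem setDiag_setDiag (a : Fin 3) (θ : Fin 3 → Fin 3 → ℂ) (x y : ℂ) :
    setDiag a (setDiag a θ x) y = setDiag a θ y := by
  ext i j; simp only [setDiag_apply]; split_ifs <;> rfl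

theorem setDiag_self (a : Fin 3) (θ : Fin 3 → Fin 3 → ℂ) : setDiag a θ (θ a a) = θ := by
  simp [setDiag]

theorem differentiableAt_setDiag {E : Type*} [NormedAddCommGroup E] [NormedSpace ℝ E]
    (a : Fin 3) {θ : E → Fin 3 → Fin 3 → ℂ} {x : E → ℂ} {e : E} (hθ : DifferentiableAt ℝ θ e)
    (hx : DifferentiableAt ℝ x e) : DifferentiableAt ℝ (fun y => setDiag a (θ y) (x y)) e := by
  refine differentiableAt_pi.2 fun i => differentiableAt_pi.2 fun j => ?_
  simp only [setDiag_apply]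
  split_ifs
  · exact hx
  · exact differentiableAt_pi.1 (differentiableAt_pi.1 hθ i) j

theorem eval_fam_setDiag {d : ℕ} (hd : 1 ≤ d) (a : Fin 3) (θ : Fin 3 → Fin 3 → ℂ) (x : ℂ)
    (z : Fin 3 → ℂ) :
    eval z (fam d G₀ (setDiag a θ x)) = eval z (fam d G₀ θ) + (x - θ a a) * z a ^ d := by
  have h : ∀ i j, setDiag a θ x i j =
      θ i j + if i = a then if j = a then x - θ a a else 0 else 0 := by
    intro i j
    rw [setDiag_apply]
    by_cases hi : i = a <;> by_cases hj : j = a <;> simp [hi, hj]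
  have h2 : ∑ i, ∑ j, (if i = a then if j = a then x - θ a a else 0 else 0) *
      eval z (famMono d i j) = (x - θ a a) * eval z (famMono d a a) := by
    rw [Finset.sum_eq_single a (fun i _ hi => by simp [hi]) (by simp),
      Finset.sum_eq_single a (fun i _ hi => by simp [hi]) (by simp)]
    simp
  rw [eval_fam, eval_fam]
  simp only [h, add_mul, Finset.sum_add_distrib]
  rw [h2]
  have : eval z (famMono d a a) = z a ^ d := by
    rw [famMono, map_mul, map_pow, eval_X, ← pow_succ, Nat.sub_add_cancel hd]
  simp [this, add_assoc]

/-- For almost all members of the family, the pullback under `σ` has no degenerate zeros. -/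
theorem null_degenerate_zeros {d : ℕ} (hd : 1 ≤ d) (a : Fin 3) {σ : ℂ → Fin 3 → ℂ} {B : Set ℂ}
    (hσ : ∀ x ∈ B, DifferentiableAt ℝ σ x) :
    μ {θ | ∃ x ∈ B, σ x a ≠ 0 ∧ eval (σ x) (fam d G₀ θ) = 0 ∧
      ¬ Function.Surjective (fderiv ℝ (fun y => eval (σ y) (fam d G₀ θ)) x)} = 0 := by
  -- The entry `(a, a)` of the argument stores the point `y`; `Ψ` replaces it by the unique
  -- coefficient of `z_a^d` for which the form vanishes at `σ y`. A degenerate zero of the member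
  -- `η` at `x` makes `η` a critical value of `Ψ`, the kernel vector coming from the `y` direction.
  set Ψ : (Fin 3 → Fin 3 → ℂ) → Fin 3 → Fin 3 → ℂ := fun θ =>
    setDiag a θ (-(eval (σ (θ a a)) (fam d G₀ (setDiag a θ 0)) * (σ (θ a a) a ^ d)⁻¹)) with hΨ
  set s : Set (Fin 3 → Fin 3 → ℂ) := {θ | DifferentiableAt ℝ Ψ θ ∧
    ∃ v, v ≠ 0 ∧ fderiv ℝ Ψ θ v = 0} with hs
  refine measure_mono_null ?_ (addHaar_image_eq_zero_of_ker μ (Ψ := Ψ) (s := s) fun θ h => h)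
  rintro η ⟨x, hx, hxa, h0, hsurj⟩
  have hformula : ∀ y, σ y a ≠ 0 → Ψ (setDiag a η y) =
      setDiag a η (η a a - eval (σ y) (fam d G₀ η) * (σ y a ^ d)⁻¹) := by
    intro y hy
    have h1 : setDiag a η y a a = y := by simp [setDiag_apply]
    simp only [hΨ, h1, setDiag_setDiag]
    rw [eval_fam_setDiag G₀ hd]
    congr 1
    have := pow_ne_zero d hy
    field_simp
    ring
  have hlin : DifferentiableAt ℝ (fun y : ℂ => setDiag a η y) x :=
    differentiableAt_setDiag a (differentiableAt_const _) differentiableAt_id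
  have hΨd : DifferentiableAt ℝ Ψ (setDiag a η x) := by
    have h1 : setDiag a η x a a = x := by simp [setDiag_apply]
    have he : DifferentiableAt ℝ (fun θ : Fin 3 → Fin 3 → ℂ => θ a a) (setDiag a η x) := by
      fun_prop
    have h2 : DifferentiableAt ℝ (fun θ : Fin 3 → Fin 3 → ℂ => σ (θ a a)) (setDiag a η x) :=
      DifferentiableAt.comp (g := σ) _ (by rw [h1]; exact hσ x hx) he
    have h3 : DifferentiableAt ℝ (fun θ : Fin 3 → Fin 3 → ℂ => (σ (θ a a) a ^ d)⁻¹)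
        (setDiag a η x) :=
      ((differentiableAt_pi.1 h2 a).fun_pow d).fun_inv (by rw [h1]; exact pow_ne_zero d hxa)
    have h4 := differentiableAt_eval_fam d G₀ h2
      (differentiableAt_setDiag a differentiableAt_id (differentiableAt_const (0 : ℂ)))
    exact differentiableAt_setDiag a differentiableAt_id (h4.fun_mul h3).fun_neg
  refine ⟨setDiag a η x, ⟨hΨd, ?_⟩, ?_⟩
  · obtain ⟨v, hv0, hv⟩ : ∃ v, v ≠ 0 ∧ fderiv ℝ (fun y => eval (σ y) (fam d G₀ η)) x v = 0 := by
      by_contra! h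
      refine hsurj (LinearMap.injective_iff_surjective (f :=
        (fderiv ℝ (fun y => eval (σ y) (fam d G₀ η)) x : ℂ →ₗ[ℝ] ℂ)).1 ?_)
      refine (injective_iff_map_eq_zero _).2 fun v hv => ?_
      by_contra hne
      exact h v hne hv
    have hW : HasFDerivAt (fun y => eval (σ y) (fam d G₀ η)) _ x :=
      (differentiableAt_eval_fam d G₀ (hσ x hx) (differentiableAt_const η)).hasFDerivAt
    have hσa : DifferentiableAt ℝ (fun y => (σ y a ^ d)⁻¹) x :=
      ((differentiableAt_pi.1 (hσ x hx) a).pow d).fun_inv (pow_ne_zero d hxa)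
    have hq := (hW.fun_mul hσa.hasFDerivAt).const_sub (η a a)
    have hdiag : HasFDerivAt (fun y : ℂ => setDiag a η y)
        (fderiv ℝ (fun y : ℂ => setDiag a η y) (η a a - eval (σ x) (fam d G₀ η) * (σ x a ^ d)⁻¹))
        (η a a - eval (σ x) (fam d G₀ η) * (σ x a ^ d)⁻¹) :=
      (differentiableAt_setDiag a (differentiableAt_const _) differentiableAt_id).hasFDerivAt
    have hcomp := HasFDerivAt.comp (g := fun y : ℂ => setDiag a η y) x hdiag hq
    have hcomp2 := HasFDerivAt.comp (g := Ψ) x hΨd.hasFDerivAt hlin.hasFDerivAt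
    have heq : (Ψ ∘ fun y : ℂ => setDiag a η y) =ᶠ[𝓝 x] (fun y : ℂ => setDiag a η y) ∘
        fun y => η a a - eval (σ y) (fam d G₀ η) * (σ y a ^ d)⁻¹ := by
      filter_upwards [(differentiableAt_pi.1 (hσ x hx) a).continuousAt.eventually_ne hxa] with y hy
      rw [Function.comp_apply, hformula y hy]
      rfl
    have hval := congrArg (fun L => L v) (hcomp2.unique (hcomp.congr_of_eventuallyEq heq))
    refine ⟨fderiv ℝ (fun y : ℂ => setDiag a η y) x v, fun h => hv0 ?_, ?_⟩
    · have h1 : HasFDerivAt (fun y : ℂ => setDiag a η y a a) ((ContinuousLinearMap.proj a).comp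
          ((ContinuousLinearMap.proj a).comp (fderiv ℝ (fun y : ℂ => setDiag a η y) x))) x :=
        hasFDerivAt_pi'.1 (hasFDerivAt_pi'.1 hlin.hasFDerivAt a) a
      have h2 : (fun y : ℂ => setDiag a η y a a) = id := by
        ext y; simp [setDiag_apply]
      rw [h2] at h1
      have := congrArg (fun L => L v) (h1.unique (hasFDerivAt_id x))
      simpa [h] using this.symm
    · simpa [hv, h0] using hval
  · rw [hformula x hxa, h0, zero_mul, sub_zero, setDiag_self]

end Null

end CP2

/-! ### Generic members are smooth, avoid a countable set and are transverse to the surface -/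

namespace CP2

open MvPolynomial MeasureTheory
open scoped NNReal

theorem sum_update_row (a : Fin 3) (θ q : Fin 3 → Fin 3 → ℂ) :
    ∑ i, ∑ j, θ i j * q i j =
      ∑ i, ∑ j, Function.update θ a 0 i j * q i j + ∑ j, θ a j * q a j := by
  rw [← Finset.add_sum_erase _ _ (Finset.mem_univ a),
    ← Finset.add_sum_erase (a := a) _ (fun i => ∑ j, Function.update θ a 0 i j * q i j)
      (Finset.mem_univ a)]
  have : ∑ i ∈ Finset.univ.erase a, ∑ j, Function.update θ a 0 i j * q i j =
      ∑ i ∈ Finset.univ.erase a, ∑ j, θ i j * q i j :=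
    Finset.sum_congr rfl fun i hi => by
      rw [Function.update_of_ne (Finset.ne_of_mem_erase hi)]
  rw [this]
  simp [add_comm]

theorem differentiableAt_update_row {E ι F : Type*} [NormedAddCommGroup E] [NormedSpace ℝ E]
    [Fintype ι] [DecidableEq ι] [NormedAddCommGroup F] [NormedSpace ℝ F] {θ : E → ι → F}
    {x : E → F} {e : E} (a : ι) (hθ : DifferentiableAt ℝ θ e) (hx : DifferentiableAt ℝ x e) :
    DifferentiableAt ℝ (fun y => Function.update (θ y) a (x y)) e := by
  refine differentiableAt_pi.2 fun i => ?_
  by_cases hi : i = a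
  · subst hi; simpa using hx
  · simpa [hi] using differentiableAt_pi.1 hθ i

/-- Almost all members of the family are smooth in the chart `z_a = 1`. -/
theorem null_singular (μ : Measure (Fin 3 → Fin 3 → ℂ)) [μ.IsAddHaarMeasure] (d : ℕ)
    (G₀ : MvPolynomial (Fin 3) ℂ) (a : Fin 3) :
    μ {θ | ∃ w : Fin 3 → ℂ, w a = 1 ∧ eval w (fam d G₀ θ) = 0 ∧
      ∀ c, eval w (pderiv c (fam d G₀ θ)) = 0} = 0 := by
  -- Row `a` of the argument stores the singular point `w`, apart from its entry `(a, a)`. On `z_a =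
  -- 1` the coefficient `θ_ac` enters `∂_c` with factor `1` for `c ≠ a`, so the vanishing of these
  -- derivatives and of the value determines the row as `row`. Singular members thus lie in the
  -- image of `Ψ`, which ignores the entry `(a, a)` and so has a kernel everywhere.
  set w : (Fin 3 → Fin 3 → ℂ) → Fin 3 → ℂ := fun θ => Function.update (θ a) a 1 with hw
  set θ₀ : (Fin 3 → Fin 3 → ℂ) → Fin 3 → Fin 3 → ℂ := fun θ => Function.update θ a 0 with hθ₀
  set D : (Fin 3 → Fin 3 → ℂ) → Fin 3 → ℂ := fun θ c =>
    eval (w θ) (pderiv c (fam d G₀ (θ₀ θ))) with hD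
  set row : (Fin 3 → Fin 3 → ℂ) → Fin 3 → ℂ := fun θ =>
    Function.update (fun c => -D θ c) a
      (-eval (w θ) (fam d G₀ (θ₀ θ)) + ∑ b ∈ Finset.univ.erase a, D θ b * w θ b) with hrow
  set Ψ : (Fin 3 → Fin 3 → ℂ) → Fin 3 → Fin 3 → ℂ := fun θ =>
    Function.update θ a (row θ) with hΨ
  refine measure_mono_null ?_ (addHaar_image_eq_zero_of_ker μ (Ψ := Ψ) (s := Set.univ)
    fun θ _ => ?_)
  · rintro η ⟨z, hza, h0, h1⟩
    have hwz : w (Function.update η a z) = z := by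
      simp [hw, Function.update_eq_self_iff, hza]
    have hθz : θ₀ (Function.update η a z) = Function.update η a 0 := by
      simp [hθ₀]
    have hDz : ∀ c, c ≠ a → D (Function.update η a z) c = -η a c := by
      intro c hc
      have h2 := h1 c
      rw [eval_pderiv_fam, sum_update_row a, ← add_assoc, ← eval_pderiv_fam] at h2
      simp only [hD, hwz, hθz]
      rw [eq_neg_iff_add_eq_zero, ← h2]
      congr 1
      rw [Finset.sum_eq_single c]
      · simp [famMono, hza, Derivation.leibniz, pderiv_X_of_ne hc.symm]
      · intro b _ hb
        simp [famMono, Derivation.leibniz, pderiv_X_of_ne hc.symm, pderiv_X_of_ne hb]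
      · simp
    refine ⟨Function.update η a z, mem_univ _, ?_⟩
    have hr : row (Function.update η a z) = η a := by
      ext c
      by_cases hc : c = a
      · subst hc
        simp only [hrow, Function.update_self]
        rw [Finset.sum_congr rfl fun b hb => by rw [hDz b (Finset.ne_of_mem_erase hb)], hwz, hθz]
        rw [eval_fam, sum_update_row c, ← add_assoc, ← eval_fam,
          ← Finset.add_sum_erase _ _ (Finset.mem_univ c)] at h0
        simp only [famMono, map_mul, map_pow, eval_X, hza, one_pow, one_mul, mul_one] at h0
        simp only [neg_mul, Finset.sum_neg_distrib]
        linear_combination -h0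
      · simp only [hrow, Function.update_of_ne hc]
        rw [hDz c hc, neg_neg]
    simp only [hΨ, hr]
    simp
  · have hwd : DifferentiableAt ℝ w θ :=
      differentiableAt_update_row a (differentiableAt_pi.1 differentiableAt_id a)
        (differentiableAt_const _)
    have hθd : DifferentiableAt ℝ θ₀ θ :=
      differentiableAt_update_row a differentiableAt_id (differentiableAt_const _)
    have hDd : ∀ c, DifferentiableAt ℝ (fun θ => D θ c) θ := fun c =>
      differentiableAt_eval_pderiv_fam d G₀ c hwd hθd
    have hrd : DifferentiableAt ℝ row θ := by
      refine differentiableAt_update_row a (differentiableAt_pi.2 fun c => (hDd c).fun_neg) ?_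
      exact (differentiableAt_eval_fam d G₀ hwd hθd).fun_neg.fun_add
        (DifferentiableAt.fun_sum fun b _ => (hDd b).fun_mul (differentiableAt_pi.1 hwd b))
    have hΨd : DifferentiableAt ℝ Ψ θ := differentiableAt_update_row a differentiableAt_id hrd
    refine ⟨hΨd, Pi.single a (Pi.single a 1), by simp, ?_⟩
    set e : Fin 3 → Fin 3 → ℂ := Pi.single a (Pi.single a 1) with he
    have hline : HasDerivAt (fun r : ℝ => θ + r • e) e 0 := by
      simpa using ((hasDerivAt_id (0 : ℝ)).smul_const e).const_add θ
    have h1 : HasDerivAt (fun r : ℝ => Ψ (θ + r • e)) (fderiv ℝ Ψ θ e) 0 :=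
      HasFDerivAt.comp_hasDerivAt (l := Ψ) (l' := fderiv ℝ Ψ θ) (0 : ℝ)
        (by rw [zero_smul, add_zero]; exact hΨd.hasFDerivAt) hline
    have hupd : ∀ (r : ℝ) (x : Fin 3 → ℂ),
        Function.update (θ + r • e) a x = Function.update θ a x := by
      intro r x
      ext i j
      by_cases hi : i = a
      · subst hi; simp
      · simp [hi, he]
    have hconst : ∀ r : ℝ, Ψ (θ + r • e) = Ψ θ := by
      intro r
      have h2 : w (θ + r • e) = w θ := by
        ext j
        by_cases hj : j = a
        · subst hj; simp [hw]
        · simp [hw, hj, he]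
      have h3 : θ₀ (θ + r • e) = θ₀ θ := hupd r 0
      have h4 : row (θ + r • e) = row θ := by simp only [hrow, hD, h2, h3]
      simp only [hΨ, h4, hupd]
    simp only [hconst] at h1
    exact h1.unique (hasDerivAt_const _ _)

theorem ae_singLocus_fam_eq_empty (μ : Measure (Fin 3 → Fin 3 → ℂ)) [μ.IsAddHaarMeasure]
    {d : ℕ} (hd : 1 ≤ d) {G₀ : MvPolynomial (Fin 3) ℂ} (hG : G₀.IsHomogeneous d) :
    ∀ᵐ θ ∂μ, singLocus (fam d G₀ θ) = ∅ := by
  have h : ∀ᵐ θ ∂μ, ∀ a, ¬ ∃ w : Fin 3 → ℂ, w a = 1 ∧ eval w (fam d G₀ θ) = 0 ∧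
      ∀ c, eval w (pderiv c (fam d G₀ θ)) = 0 := by
    refine ae_all_iff.2 fun a => ?_
    rw [ae_iff]
    simpa only [not_not] using null_singular μ d G₀ a
  filter_upwards [h] with θ hθ
  refine eq_empty_of_forall_notMem fun p hp => ?_
  obtain ⟨a, ha⟩ := exists_mem_affineOpen p
  rw [← proj_chart ha, proj_mem_singLocus (isHomogeneous_fam hd hG θ) (chart_ne_zero ha)] at hp
  exact hθ a ⟨chart a p, chart_self ha, hp⟩

theorem ae_disjoint_zeroLocus_fam (μ : Measure (Fin 3 → Fin 3 → ℂ)) [μ.IsAddHaarMeasure]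
    {d : ℕ} (hd : 1 ≤ d) (G₀ : MvPolynomial (Fin 3) ℂ) {S : Set CP2}
    (hS : S.Countable) : ∀ᵐ θ ∂μ, Disjoint (zeroLocus (fam d G₀ θ)) S := by
  have h : ∀ᵐ θ ∂μ, ∀ p ∈ S, p ∉ zeroLocus (fam d G₀ θ) := by
    refine (ae_ball_iff hS).2 fun p _ => ?_
    obtain ⟨a, ha⟩ := exists_mem_affineOpen p
    rw [ae_iff]
    -- For a constant map every zero is degenerate, so passing through `p` is itself a null event.
    refine measure_mono_null ?_ (null_degenerate_zeros μ G₀ hd a (σ := fun _ => p.rep) (B := {0})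
      fun x _ => differentiableAt_const _)
    intro θ hθ
    rw [mem_ofPred_eq, not_not] at hθ
    refine ⟨0, rfl, ha, hθ, fun hs => ?_⟩
    rw [fderiv_fun_const] at hs
    obtain ⟨y, hy⟩ := hs 1
    simp at hy
  filter_upwards [h] with θ hθ
  exact disjoint_left.2 fun p hp hpS => hθ p hpS hp

theorem normDeriv_add (a : Fin 3) (z u v : Fin 3 → ℂ) :
    normDeriv a z u + normDeriv a z v = normDeriv a z (u + v) := by
  ext i
  simp [normDeriv]
  ring

theorem normDeriv_smul_of_eq_zero {a : Fin 3} {z v : Fin 3 → ℂ} (ha : z a ≠ 0) (hv : v a = 0) :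
    normDeriv a z (z a • v) = v := by
  ext i
  simp [normDeriv, ha, hv]

/-- By Lindelöf, countably many patches cover the cone of regular points, and almost every member
has only nondegenerate zeros on all their perturbations. At such a zero `dG` is already onto when
restricted to the surface, so subtracting a tangent vector of the surface brings any `v` into `ker
dG`. -/
theorem ae_transverse_fam (μ : Measure (Fin 3 → Fin 3 → ℂ)) [μ.IsAddHaarMeasure]
    {P : (Fin 3 → ℂ) → Fin 3 → ℂ} (hP : IsHomPerturbation P) (t : ℝ)
    {F : MvPolynomial (Fin 3) ℂ} {k : ℕ} (hF : F.IsHomogeneous k)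
    {d : ℕ} (hd : 1 ≤ d) {G₀ : MvPolynomial (Fin 3) ℂ} (hG : G₀.IsHomogeneous d) :
    ∀ᵐ θ ∂μ, Transverse (zeroLocus (fam d G₀ θ)) (range (hP.smoothMap t (regLocus F)).toFun) := by
  set T : Set (Fin 3 → ℂ) := {z | z ≠ 0 ∧ eval z F = 0 ∧ ∃ i, eval z (pderiv i F) ≠ 0} with hT
  have hparam : ∀ z, ∃ (σ : ℂ → Fin 3 → ℂ) (B : Set ℂ), z ∈ T → IsOpen B ∧
      (∀ x ∈ B, ContDiffAt ℝ ∞ σ x ∧ σ x ≠ 0 ∧ proj (σ x) ∈ regLocus F) ∧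
      ∀ᶠ w in 𝓝 z, eval w F = 0 → ∃ x ∈ B, ∃ c : ℂ, c ≠ 0 ∧ w = c • σ x := by
    intro z
    by_cases hz : z ∈ T
    · obtain ⟨σ, B, h⟩ := exists_param_regLocus hF hz.1 hz.2.1 hz.2.2
      exact ⟨σ, B, fun _ => h⟩
    · exact ⟨0, ∅, fun h => absurd h hz⟩
  choose σ B hσB using hparam
  obtain ⟨N, hNT, hNc, hN⟩ := TopologicalSpace.countable_cover_nhdsWithin (s := T)
    (f := fun z => {w | eval w F = 0 → ∃ x ∈ B z, ∃ c : ℂ, c ≠ 0 ∧ w = c • σ z x})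
    fun z hz => mem_nhdsWithin_of_mem_nhds (hσB z hz).2.2
  have h : ∀ᵐ θ ∂μ, ∀ z ∈ N, ∀ a, ¬ ∃ x ∈ B z, (σ z x + t • P (σ z x)) a ≠ 0 ∧
      eval (σ z x + t • P (σ z x)) (fam d G₀ θ) = 0 ∧ ¬ Function.Surjective
        (fderiv ℝ (fun y => eval (σ z y + t • P (σ z y)) (fam d G₀ θ)) x) := by
    refine (ae_ball_iff hNc).2 fun z hz => ae_all_iff.2 fun a => ?_
    rw [ae_iff]
    simp only [not_not]
    refine null_degenerate_zeros μ G₀ hd a (σ := fun x => σ z x + t • P (σ z x)) fun x hx => ?_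
    obtain ⟨h1, h2, -⟩ := (hσB z (hNT hz)).2.1 x hx
    exact ((hP.contDiffAt_pert t h2).comp x h1).differentiableAt (by simp)
  filter_upwards [h] with θ hθ
  rintro q ⟨hqG, ⟨⟨p, hp⟩, hpq⟩⟩ a ha v hv
  change pertMap P t p = q at hpq
  have hpT : p.rep ∈ T := by
    have := hp
    rw [← proj_rep p, proj_mem_regLocus hF p.rep_nonzero] at this
    exact ⟨p.rep_nonzero, this⟩
  obtain ⟨z, hzN, hz⟩ := mem_iUnion₂.1 (hN hpT)
  obtain ⟨x, hxB, c, hc, hpx⟩ := hz hpT.2.1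
  obtain ⟨hBo, hB, -⟩ := hσB z (hNT hzN)
  obtain ⟨hσs, hσ0, -⟩ := hB x hxB
  set τ : ℂ → Fin 3 → ℂ := fun y => σ z y + t • P (σ z y) with hτ
  have hτs : ContDiffAt ℝ ∞ τ x := (hP.contDiffAt_pert t hσ0).comp x hσs
  have hτ0 : τ x ≠ 0 := hP.ne_zero t _ hσ0
  have hq : proj (τ x) = q := by
    rw [← hpq, ← proj_rep p, hpx, proj_smul hσ0 hc, hP.pertMap_proj t hσ0]
  rw [← hq] at hqG ha ⊢
  rw [proj_mem_affineOpen hτ0] at ha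
  rw [proj_mem_zeroLocus (isHomogeneous_fam hd hG θ) hτ0] at hqG
  set G := fam d G₀ θ with hGdef
  have hsurj : Function.Surjective (fderiv ℝ (fun y => eval (τ y) G) x) := by
    by_contra hns
    exact hθ z hzN a ⟨x, hxB, ha, hqG, hns⟩
  have hτd := (hτs.differentiableAt (by simp)).hasFDerivAt
  have hcomp : HasFDerivAt (fun y => eval (τ y) G) _ x := (hasFDerivAt_real_eval G (τ x)).comp x hτd
  rw [hcomp.fderiv] at hsurj
  obtain ⟨ξ, hξ⟩ := hsurj (evalDeriv G (τ x) (τ x a • v))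
  have hξ' : evalDeriv G (τ x) (fderiv ℝ τ x ξ) = evalDeriv G (τ x) (τ x a • v) := hξ
  -- Nondegeneracy also forces `dG ≠ 0`, so every vector of `ker dG` is tangent to the zero locus.
  have hreg : ∃ i, eval (τ x) (pderiv i G) ≠ 0 := by
    by_contra! h0
    obtain ⟨y, hy⟩ := hsurj 1
    have : evalDeriv G (τ x) (fderiv ℝ τ x y) = 1 := hy
    rw [evalDeriv_apply] at this
    simp [h0] at this
  obtain ⟨y, hy, hy0, hyd, hyG⟩ := exists_curve_of_evalDeriv_eq_zero hqG hreg
    (v := τ x a • v - fderiv ℝ τ x ξ) (by rw [map_sub, hξ', sub_self])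
  have hy0' : y 0 ≠ 0 := by rwa [hy0]
  have h1 := normDeriv_mem_tangentVectors (S := zeroLocus G) (a := a) hy (by rwa [hy0]) hyd (by
    filter_upwards [hyG, hy.continuousAt.eventually_ne hy0'] with s hs hs0
    rwa [proj_mem_zeroLocus (isHomogeneous_fam hd hG θ) hs0])
  rw [hy0] at h1
  have hline : HasDerivAt (fun s : ℝ => x + s • ξ) ξ 0 := by
    simpa using ((hasDerivAt_id (0 : ℝ)).smul_const ξ).const_add x
  have hl0 : x + (0 : ℝ) • ξ = x := by simp
  have hlt : Tendsto (fun s : ℝ => x + s • ξ) (𝓝 0) (𝓝 x) := by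
    have := hline.continuousAt.tendsto
    rwa [hl0] at this
  have h2 := normDeriv_mem_tangentVectors (a := a) (z := fun s : ℝ => τ (x + s • ξ))
    (v := fderiv ℝ τ x ξ)
    (S := range (hP.smoothMap t (regLocus F)).toFun)
    (ContDiffAt.comp (g := τ) (f := fun s : ℝ => x + s • ξ) (0 : ℝ) (by rwa [hl0])
      (contDiffAt_const.add (contDiffAt_id.smul contDiffAt_const))) (by rwa [hl0])
    (HasFDerivAt.comp_hasDerivAt (l := τ) (l' := fderiv ℝ τ x) (0 : ℝ) (by rwa [hl0]) hline) (by
      filter_upwards [hlt.eventually (hBo.mem_nhds hxB)] with s hs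
      exact hP.proj_pert_mem_range t (hB _ hs).2.1 (hB _ hs).2.2)
  simp only [hl0] at h2
  refine ⟨_, h1, _, h2, ?_⟩
  rw [normDeriv_add, sub_add_cancel, normDeriv_smul_of_eq_zero ha hv]

end CP2

namespace CP2

open MvPolynomial MeasureTheory
open scoped NNReal

/-! ### A perturbation with infinitely many nondegenerate zeros -/

/-- Bounded support of `h` makes the field vanish near any `z ≠ 0` with `z_a = 0`, which gives
smoothness there. Adding `t P z` leaves `z_a` unchanged, and `P z = 0` when `z_a = 0`, so no nonzero
vector is sent to `0`. -/
theorem isHomPerturbation_single {a c : Fin 3} (hac : a ≠ c) {h : (Fin 3 → ℂ) → ℂ}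
    (hh : ContDiff ℝ ∞ h) {R : ℝ} (hR : ∀ w, h w ≠ 0 → ‖w‖ ≤ R) :
    IsHomPerturbation fun z => Pi.single c (z a * h ((z a)⁻¹ • z)) where
  smooth z hz := by
    have hsingle : ∀ f : (Fin 3 → ℂ) → ℂ, ContDiffAt ℝ ∞ f z →
        ContDiffAt ℝ ∞ (fun z => (Pi.single c (f z) : Fin 3 → ℂ)) z := by
      intro f hf
      refine contDiffAt_pi.2 fun i => ?_
      by_cases hi : i = c
      · subst hi; simpa using hf
      · simpa [hi] using contDiffAt_const
    have hcoord : ContDiffAt ℝ ∞ (fun z : Fin 3 → ℂ => z a) z := (contDiff_apply ℝ ℂ a).contDiffAt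
    by_cases ha : z a = 0
    · have h1 : ∀ᶠ w : Fin 3 → ℂ in 𝓝 z, R * ‖w a‖ < ‖w‖ := by
        refine ContinuousAt.eventually_lt
          (continuousAt_const.mul (continuous_apply a).continuousAt.norm)
          continuousAt_id.norm ?_
        simpa [ha] using hz
      refine (contDiffAt_const (c := (0 : Fin 3 → ℂ))).congr_of_eventuallyEq ?_
      filter_upwards [h1] with w hw
      have : w a * h ((w a)⁻¹ • w) = 0 := by
        by_contra hne
        have hwa := norm_pos_iff.2 (left_ne_zero_of_mul hne)
        have h2 := hR _ (right_ne_zero_of_mul hne)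
        rw [norm_smul, norm_inv, inv_mul_le_iff₀ hwa] at h2
        linarith
      rw [this, Pi.single_zero]
    · refine hsingle _ (hcoord.mul (hh.contDiffAt.comp z ?_))
      exact contDiffAt_normalize (z := fun z => z) contDiffAt_id ha
  hom s z := by
    rw [← Pi.single_smul]
    congr 1
    by_cases hs : s = 0
    · simp [hs]
    · rw [Pi.smul_apply, smul_eq_mul, smul_eq_mul, smul_smul, mul_inv, mul_comm s⁻¹,
        mul_assoc _ s⁻¹, inv_mul_cancel₀ hs, mul_one]
      ring
  ne_zero t z hz h0 := by
    have h1 := congrFun h0 a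
    simp only [Pi.add_apply, Pi.smul_apply, Pi.single_eq_of_ne hac, smul_zero, add_zero,
      Pi.zero_apply] at h1
    simp only [h1, zero_mul, Pi.single_zero, smul_zero, add_zero] at h0
    exact hz h0

/-- On the patch `σ`, where the bump equals `1`, the field adds `u(y - q_b)` to the coordinate `c`
and leaves `a` and `b` alone. As `∂F/∂z_c ≠ 0`, the nondegenerate zeros of `u` become nondegenerate
zeros of `F` on the perturbed patch for every `t ≠ 0`. The ball `A` contains the support of `P` up
to scaling. -/
theorem exists_perturbation {F : MvPolynomial (Fin 3) ℂ} {k : ℕ} (hF : F.IsHomogeneous k)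
    {q : Fin 3 → ℂ} {a b c : Fin 3} (hac : a ≠ c) (hba : b ≠ a) (hbc : b ≠ c) (hqa : q a = 1)
    (h0 : eval q F = 0) (hc : eval q (pderiv c F) ≠ 0) :
    ∃ (P : (Fin 3 → ℂ) → Fin 3 → ℂ) (A : Set (Fin 3 → ℂ)) (σ : ℂ → Fin 3 → ℂ) (U : Set ℂ)
      (x : ℕ → ℂ), IsHomPerturbation P ∧ IsCompact A ∧
      (∀ z ∈ A, z ≠ 0 ∧ ∃ i, eval z (pderiv i F) ≠ 0) ∧
      (∀ z, P z ≠ 0 → ∃ s : ℂ, s ≠ 0 ∧ s • z ∈ A) ∧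
      IsOpen U ∧
      (∀ y ∈ U, ContDiffAt ℝ ∞ σ y ∧ proj (σ y) ∈ regLocus F ∧ ∀ t : ℝ,
        (σ y + t • P (σ y)) a = 1 ∧ (σ y + t • P (σ y)) b = y) ∧
      Function.Injective x ∧ ∀ n, x n ∈ U ∧ ∀ t : ℝ, t ≠ 0 →
        eval (σ (x n) + t • P (σ (x n))) F = 0 ∧
        Function.Surjective (fderiv ℝ (fun y => eval (σ y + t • P (σ y)) F) (x n)) := by
  obtain ⟨u, s, hu, hsinj, hs0, hs⟩ := exists_smooth_accumulating_zeros
  have hev : ∀ᶠ w in 𝓝 q, w a ≠ 0 ∧ eval w (pderiv c F) ≠ 0 :=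
    ((continuous_apply a).continuousAt.eventually_ne (by rw [hqa]; exact one_ne_zero)).and
      ((contDiff_eval (pderiv c F)).continuous.continuousAt.eventually_ne hc)
  obtain ⟨r, hr, hrA⟩ := Metric.nhds_basis_closedBall.eventually_iff.1 hev
  let χ : ContDiffBump q := ⟨r / 2, r, by positivity, by linarith⟩
  set h : (Fin 3 → ℂ) → ℂ := fun w => (χ w : ℂ) * u (w b - q b) with hh
  have hcoord : ContDiff ℝ ∞ (fun w : Fin 3 → ℂ => w b - q b) :=
    (contDiff_apply ℝ ℂ b).sub contDiff_const
  have hhs : ContDiff ℝ ∞ h :=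
    (Complex.ofRealCLM.contDiff.comp χ.contDiff).mul (hu.comp hcoord)
  have hball : ∀ w, h w ≠ 0 → w ∈ Metric.closedBall q r := by
    intro w hw
    have h1 : χ w ≠ 0 := by simpa using left_ne_zero_of_mul hw
    have h2 : w ∈ Function.support χ := h1
    rw [χ.support_eq] at h2
    exact Metric.ball_subset_closedBall h2
  have hR : ∀ w, h w ≠ 0 → ‖w‖ ≤ ‖q‖ + r := by
    intro w hw
    have h1 := hball w hw
    rw [Metric.mem_closedBall, dist_eq_norm] at h1
    linarith [norm_le_norm_add_norm_sub' w q]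
  have hP := isHomPerturbation_single hac hhs hR
  set P : (Fin 3 → ℂ) → Fin 3 → ℂ := fun z => Pi.single c (z a * h ((z a)⁻¹ • z)) with hPdef
  obtain ⟨σ, hσ, hσq, h1, -⟩ := exists_local_param hbc h0 hc
  have hthird : a ≠ b := hba.symm
  have hreg : ∀ᶠ y in 𝓝 (q b), proj (σ y) ∈ regLocus F :=
    eventually_proj_mem_regLocus hF hσ.continuousAt
      (by rw [hσq]; rintro rfl; simp at hqa) (h1.mono fun x h => h.1) ⟨c, by rwa [hσq]⟩
  have hin : ∀ᶠ y in 𝓝 (q b), σ y ∈ Metric.ball q (r / 2) := by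
    refine hσ.continuousAt.eventually (Metric.isOpen_ball.mem_nhds ?_)
    rw [hσq]; exact Metric.mem_ball_self (by positivity)
  obtain ⟨U, hU, hUo, hqU⟩ := eventually_nhds_iff.1
    ((hσ.eventually (by simp)).and (hreg.and (h1.and hin)))
  have hσa : ∀ y ∈ U, σ y a = 1 := fun y hy => by
    rw [(hU y hy).2.2.1.2.2 a hthird hac, hqa]
  have hPσ : ∀ y ∈ U, P (σ y) = Pi.single c (u (y - q b)) := by
    intro y hy
    simp only [hPdef, hh, hσa y hy, inv_one, one_smul, one_mul, (hU y hy).2.2.1.2.1]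
    rw [χ.one_of_mem_closedBall (Metric.ball_subset_closedBall (hU y hy).2.2.2)]
    simp
  have hxt : Tendsto (fun n => q b + s n) atTop (𝓝 (q b)) := by
    simpa using hs0.const_add (q b)
  -- Dropping the first `N` zeros leaves a sequence contained in `U`.
  obtain ⟨N, hN⟩ := eventually_atTop.1 (hxt.eventually (hUo.mem_nhds hqU))
  refine ⟨P, Metric.closedBall q r, σ, U, fun n => q b + s (n + N), hP,
    isCompact_closedBall q r, ?_, ?_, hUo, ?_, ?_, ?_⟩
  · intro z hz
    refine ⟨?_, c, (hrA hz).2⟩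
    rintro rfl
    exact (hrA hz).1 rfl
  · intro z hz
    have h2 : z a * h ((z a)⁻¹ • z) ≠ 0 := fun h2 => hz (by simp [hPdef, h2])
    exact ⟨(z a)⁻¹, inv_ne_zero (left_ne_zero_of_mul h2), hball _ (right_ne_zero_of_mul h2)⟩
  · intro y hy
    refine ⟨(hU y hy).1.of_le le_top, (hU y hy).2.1, fun t => ⟨?_, ?_⟩⟩
    · rw [Pi.add_apply, Pi.smul_apply, hPσ y hy, Pi.single_eq_of_ne hac, smul_zero, add_zero,
        hσa y hy]
    · rw [Pi.add_apply, Pi.smul_apply, hPσ y hy, Pi.single_eq_of_ne hbc, smul_zero, add_zero,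
        (hU y hy).2.2.1.2.1]
  · intro m n hmn
    exact add_right_cancel (hsinj (add_left_cancel hmn))
  · intro n
    set y₀ := q b + s (n + N) with hy₀
    have hy₀U : y₀ ∈ U := hN _ (Nat.le_add_left _ _)
    have hsub : y₀ - q b = s (n + N) := by rw [hy₀]; ring
    have hnear : ∀ᶠ y in 𝓝 y₀, y ∈ U := hUo.mem_nhds hy₀U
    refine ⟨hy₀U, fun t ht => ⟨?_, ?_⟩⟩
    · rw [hPσ y₀ hy₀U, hsub, (hs _).1, Pi.single_zero, smul_zero, add_zero]
      exact (hU y₀ hy₀U).2.2.1.1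
    · have hσd : HasFDerivAt σ (fderiv ℝ σ y₀) y₀ :=
        ((hU y₀ hy₀U).1.differentiableAt (by simp)).hasFDerivAt
      have hud : HasFDerivAt (fun y => u (y - q b)) (fderiv ℝ u (s (n + N))) y₀ := by
        have h2 : HasFDerivAt u (fderiv ℝ u (s (n + N))) (y₀ - q b) := by
          rw [hsub]; exact (hu.differentiable (by simp) _).hasFDerivAt
        exact h2.comp y₀ ((hasFDerivAt_id y₀).sub_const (q b))
      set S : ℂ →L[ℝ] Fin 3 → ℂ := ContinuousLinearMap.single ℝ (fun _ : Fin 3 => ℂ) c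
      have hτd : HasFDerivAt (fun y => σ y + t • S (u (y - q b)))
          (fderiv ℝ σ y₀ + t • S.comp (fderiv ℝ u (s (n + N)))) y₀ :=
        hσd.add ((S.hasFDerivAt.comp y₀ hud).const_smul t)
      have hval : σ y₀ + t • S (u (y₀ - q b)) = σ y₀ := by
        rw [hsub, (hs _).1, map_zero, smul_zero, add_zero]
      have hE : HasFDerivAt (fun y => eval (σ y + t • S (u (y - q b))) F)
          (((evalDeriv F (σ y₀)).restrictScalars ℝ).comp
            (fderiv ℝ σ y₀ + t • S.comp (fderiv ℝ u (s (n + N))))) y₀ :=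
        HasFDerivAt.comp (g := fun z => eval z F) y₀
          (by rw [hval]; exact hasFDerivAt_real_eval F (σ y₀)) hτd
      have heq : (fun y => eval (σ y + t • P (σ y)) F) =ᶠ[𝓝 y₀]
          fun y => eval (σ y + t • S (u (y - q b))) F := by
        filter_upwards [hnear] with y hy
        rw [hPσ y hy]
        rfl
      -- The unperturbed patch stays in `F = 0`, so the first variation of `F` is `t ∂_cF · du`.
      have hker : ∀ v, evalDeriv F (σ y₀) (fderiv ℝ σ y₀ v) = 0 := by
        intro v
        have h2 : HasFDerivAt (fun y => eval (σ y) F) _ y₀ :=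
          (hasFDerivAt_real_eval F (σ y₀)).comp y₀ hσd
        have h3 := h2.unique ((hasFDerivAt_const (0 : ℂ) y₀).congr_of_eventuallyEq
          (hnear.mono fun y hy => (hU y hy).2.2.1.1))
        exact congrArg (fun L => L v) h3
      have hcne : eval (σ y₀) (pderiv c F) ≠ 0 := by
        refine (hrA ?_).2
        exact Metric.ball_subset_closedBall
          (Metric.ball_subset_ball (by linarith) (hU y₀ hy₀U).2.2.2)
      rw [heq.fderiv_eq, hE.fderiv]
      refine LinearMap.injective_iff_surjective (f := ((((evalDeriv F (σ y₀)).restrictScalars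
        ℝ).comp (fderiv ℝ σ y₀ + t • S.comp (fderiv ℝ u (s (n + N)))) : ℂ →L[ℝ] ℂ) :
          ℂ →ₗ[ℝ] ℂ)).1 ?_
      refine (injective_iff_map_eq_zero _).2 fun v hv => ?_
      have hv' : evalDeriv F (σ y₀) (fderiv ℝ σ y₀ v + t • S (fderiv ℝ u (s (n + N)) v)) = 0 := hv
      have hS : t • S (fderiv ℝ u (s (n + N)) v) =
          Pi.single c ((t : ℂ) * fderiv ℝ u (s (n + N)) v) := by
        change t • (Pi.single c (fderiv ℝ u (s (n + N)) v) : Fin 3 → ℂ) = _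
        rw [← Pi.single_smul, Complex.real_smul]
      rw [map_add, hker, zero_add, hS, evalDeriv_single] at hv'
      have h4 := (mul_eq_zero.1 ((mul_eq_zero.1 hv').resolve_left hcne)).resolve_left
        (by exact_mod_cast ht)
      exact (injective_iff_map_eq_zero _).1 (hs (n + N)).2 v h4

/-! ### Stability of nondegenerate zeros -/

/-- The map `(θ, y) ↦ (θ, E(θ, y))` has surjective differential and is therefore open at the point;
its image contains all `(θ, 0)` with `θ` near `a`. -/
theorem eventually_exists_zero {A B C : Type*} [NormedAddCommGroup A] [NormedSpace ℝ A]
    [CompleteSpace A] [NormedAddCommGroup B] [NormedSpace ℝ B] [CompleteSpace B]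
    [NormedAddCommGroup C] [NormedSpace ℝ C] [CompleteSpace C] {E : A × B → C}
    {E' : A × B →L[ℝ] C} {a : A} {b : B} (hE : HasStrictFDerivAt E E' (a, b)) (h0 : E (a, b) = 0)
    (hsurj : ∀ e, ∃ v, E' (0, v) = e) {W : Set B} (hW : W ∈ 𝓝 b) :
    ∀ᶠ θ in 𝓝 a, ∃ y ∈ W, E (θ, y) = 0 := by
  have hf : HasStrictFDerivAt (fun p : A × B => (p.1, E p))
      ((ContinuousLinearMap.fst ℝ A B).prod E') (a, b) := hasStrictFDerivAt_fst.prodMk hE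
  have hr : (((ContinuousLinearMap.fst ℝ A B).prod E') : A × B →L[ℝ] A × C).range = ⊤ := by
    refine LinearMap.range_eq_top.2 fun ⟨θ, e⟩ => ?_
    obtain ⟨v, hv⟩ := hsurj (e - E' (θ, 0))
    refine ⟨(θ, v), Prod.ext rfl ?_⟩
    have : E' (θ, v) = E' (θ, 0) + E' (0, v) := by rw [← map_add]; simp
    change E' (θ, v) = e
    rw [this, hv]
    abel
  have hmap := hf.map_nhds_eq_of_surj hr
  have himg : (fun p : A × B => (p.1, E p)) '' (Set.univ ×ˢ W) ∈ 𝓝 (a, (0 : C)) := by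
    rw [← h0, ← hmap]
    exact image_mem_map (prod_mem_nhds univ_mem hW)
  have hc : Tendsto (fun θ : A => (θ, (0 : C))) (𝓝 a) (𝓝 (a, 0)) := by
    exact (Continuous.prodMk_left (0 : C)).tendsto a
  filter_upwards [hc.eventually himg] with θ hθ
  obtain ⟨⟨θ', y⟩, ⟨-, hy⟩, hp⟩ := hθ
  obtain ⟨rfl, h2⟩ := Prod.ext_iff.1 hp
  exact ⟨y, hy, h2⟩

theorem contDiffAt_eval_fam (d : ℕ) (G₀ : MvPolynomial (Fin 3) ℂ) {τ : ℂ → Fin 3 → ℂ} {y : ℂ}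
    (hτ : ContDiffAt ℝ ∞ τ y) (θ : Fin 3 → Fin 3 → ℂ) :
    ContDiffAt ℝ ∞ (fun p : (Fin 3 → Fin 3 → ℂ) × ℂ => eval (τ p.2) (fam d G₀ p.1)) (θ, y) := by
  simp only [eval_fam]
  have h : ∀ G : MvPolynomial (Fin 3) ℂ, ContDiffAt ℝ ∞
      (fun p : (Fin 3 → Fin 3 → ℂ) × ℂ => eval (τ p.2) G) (θ, y) := fun G =>
    (contDiff_real_eval G).contDiffAt.comp (θ, y)
      (ContDiffAt.comp (g := τ) (f := Prod.snd) (θ, y) hτ contDiffAt_snd)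
  refine (h _).add (ContDiffAt.sum fun i _ => ContDiffAt.sum fun j _ => ContDiffAt.mul ?_ (h _))
  exact contDiffAt_pi.1 (contDiffAt_pi.1 contDiffAt_fst i) j

theorem fam_zero (d : ℕ) (G₀ : MvPolynomial (Fin 3) ℂ) : fam d G₀ 0 = G₀ := by
  simp [fam]

/-- The first `m` zeros have disjoint neighbourhoods, each retaining a zero for small `θ`. Different
parameters give different points of `CP²`, since normalizing the coordinate `a` to `1` lets `y` be
read off the coordinate `b`. -/
theorem eventually_le_encard {d : ℕ} (hd : 1 ≤ d) {G₀ : MvPolynomial (Fin 3) ℂ}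
    (hG : G₀.IsHomogeneous d) {S : Set CP2} {τ : ℂ → Fin 3 → ℂ} {U : Set ℂ} (hU : IsOpen U)
    {a b : Fin 3} (hτ : ∀ y ∈ U, ContDiffAt ℝ ∞ τ y ∧ proj (τ y) ∈ S ∧ τ y a = 1 ∧ τ y b = y)
    {x : ℕ → ℂ} (hx : Function.Injective x) (hxU : ∀ n, x n ∈ U ∧ eval (τ (x n)) G₀ = 0 ∧
      Function.Surjective (fderiv ℝ (fun y => eval (τ y) G₀) (x n))) (m : ℕ) :
    ∀ᶠ θ in 𝓝 0, (m : ℕ∞) ≤ (zeroLocus (fam d G₀ θ) ∩ S).encard := by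
  obtain ⟨W, hW, hdisj⟩ := (Set.finite_range fun i : Fin m => x i).t2_separation
  have h : ∀ i : Fin m, ∀ᶠ θ in 𝓝 0, ∃ y ∈ W (x i) ∩ U, eval (τ y) (fam d G₀ θ) = 0 := by
    intro i
    obtain ⟨hiU, hi0, his⟩ := hxU i
    have hcd := contDiffAt_eval_fam d G₀ (hτ _ hiU).1 0
    have hstrict := hcd.hasStrictFDerivAt (by simp)
    refine eventually_exists_zero hstrict (by simpa [fam_zero] using hi0) (fun e => ?_)
      (inter_mem ((hW (x i)).2.mem_nhds (hW (x i)).1) (hU.mem_nhds hiU))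
    obtain ⟨v, hv⟩ := his e
    refine ⟨v, ?_⟩
    have h1 : HasFDerivAt (fun y : ℂ => ((0 : Fin 3 → Fin 3 → ℂ), y))
        (ContinuousLinearMap.inr ℝ (Fin 3 → Fin 3 → ℂ) ℂ) (x i) := hasFDerivAt_prodMk_right _ _
    have h2 := HasFDerivAt.comp (x i) hstrict.hasFDerivAt h1
    have h3 : ((fun p : (Fin 3 → Fin 3 → ℂ) × ℂ => eval (τ p.2) (fam d G₀ p.1)) ∘
        fun y : ℂ => ((0 : Fin 3 → Fin 3 → ℂ), y)) = fun y => eval (τ y) G₀ := by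
      ext y
      simp [fam_zero]
    rw [h3] at h2
    rw [← hv, h2.fderiv]
    rfl
  filter_upwards [eventually_all.2 h] with θ hθ
  choose y hy hy0 using hθ
  have hτ0 : ∀ i, τ (y i) ≠ 0 := fun i h0 => by
    have := (hτ _ (hy i).2).2.2.1
    simp [h0] at this
  have hinj : Function.Injective fun i => proj (τ (y i)) := by
    intro i j hij
    obtain ⟨s, -, hs⟩ := (proj_eq_proj_iff (hτ0 i) (hτ0 j)).1 hij
    have h1 := congrFun hs a
    rw [Pi.smul_apply, (hτ _ (hy i).2).2.2.1, (hτ _ (hy j).2).2.2.1, smul_eq_mul, mul_one] at h1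
    have h2 := congrFun hs b
    rw [Pi.smul_apply, (hτ _ (hy i).2).2.2.2, (hτ _ (hy j).2).2.2.2, ← h1, one_smul] at h2
    by_contra hne
    have hxne : x i ≠ x j := fun h => hne (Fin.ext (hx h))
    exact disjoint_left.1 (hdisj (mem_range_self i) (mem_range_self j) hxne) (hy i).1
      (h2 ▸ (hy j).1)
  have hsub : range (fun i => proj (τ (y i))) ⊆ zeroLocus (fam d G₀ θ) ∩ S := by
    rintro _ ⟨i, rfl⟩
    exact ⟨(proj_mem_zeroLocus (isHomogeneous_fam hd hG θ) (hτ0 i)).2 (hy0 i),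
      (hτ _ (hy i).2).2.1⟩
  calc (m : ℕ∞) = (range fun i => proj (τ (y i))).encard := by
        rw [← image_univ, hinj.encard_image, Set.encard_univ]
        simp
    _ ≤ _ := encard_le_encard hsub

end CP2

/-! ### Assembly: the compact set, the generic member and the theorem -/

namespace CP2

open MvPolynomial MeasureTheory
open scoped NNReal

theorem exists_normalized_regular_point {F : MvPolynomial (Fin 3) ℂ} {k : ℕ}
    (hF : F.IsHomogeneous k) (hk : 1 ≤ k) (hsq : Squarefree F) :
    ∃ (q : Fin 3 → ℂ) (a b c : Fin 3), a ≠ c ∧ b ≠ a ∧ b ≠ c ∧ q a = 1 ∧ eval q F = 0 ∧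
      eval q (pderiv c F) ≠ 0 := by
  obtain ⟨z, hz, h0, c, hc⟩ := exists_regular_point hF hk hsq
  obtain ⟨a, hac, ha⟩ := exists_ne_coord_ne_zero hF hz h0 hc
  obtain ⟨b, hba, hbc⟩ : ∃ b, b ≠ a ∧ b ≠ c := by clear * - hac; revert a c; decide
  refine ⟨(z a)⁻¹ • z, a, b, c, hac, hba, hbc, by simp [ha], ?_, ?_⟩
  · rw [eval_smul_of_isHomogeneous hF, h0, mul_zero]
  · rw [eval_smul_of_isHomogeneous hF.pderiv]
    exact mul_ne_zero (pow_ne_zero _ (inv_ne_zero ha)) hc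

theorem pertMap_eq_self {P : (Fin 3 → ℂ) → Fin 3 → ℂ} (t : ℝ) {p : CP2} (h : P p.rep = 0) :
    pertMap P t p = p := by
  rw [pertMap, h, smul_zero, add_zero, proj_rep]

/-- The regular points of `F = 0` represented in a compact set of points of nonzero gradient form
a compact set. -/
theorem isCompact_regLocus_preimage {F : MvPolynomial (Fin 3) ℂ} {k : ℕ} (hF : F.IsHomogeneous k)
    {A : Set (Fin 3 → ℂ)} (hA : IsCompact A)
    (hreg : ∀ z ∈ A, z ≠ 0 ∧ ∃ i, eval z (pderiv i F) ≠ 0) :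
    IsCompact {p : regLocus F | p.1 ∈ proj '' (A ∩ {z | eval z F = 0})} := by
  rw [IsEmbedding.subtypeVal.isCompact_iff]
  have h : Subtype.val '' {p : regLocus F | p.1 ∈ proj '' (A ∩ {z | eval z F = 0})} =
      proj '' (A ∩ {z | eval z F = 0}) := by
    refine subset_antisymm (by rintro _ ⟨p, hp, rfl⟩; exact hp) ?_
    rintro _ ⟨z, hz, rfl⟩
    exact ⟨⟨proj z, (proj_mem_regLocus hF (hreg z hz.1).1).2 ⟨hz.2, (hreg z hz.1).2⟩⟩,
      ⟨z, hz, rfl⟩, rfl⟩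
  rw [h]
  refine (hA.inter_right (isClosed_eq (contDiff_eval F).continuous
    continuous_const)).image_of_continuousOn
    fun z hz => (continuousAt_proj (hreg z hz.1).1).continuousWithinAt

/-- A set of full Haar measure is dense, so the generic conditions can be met arbitrarily close to
`θ = 0`, inside the open range where the chosen intersections persist. -/
theorem exists_fam_mem {P : (Fin 3 → ℂ) → Fin 3 → ℂ} (hP : IsHomPerturbation P) (t : ℝ)
    {F : MvPolynomial (Fin 3) ℂ} {k : ℕ} (hF : F.IsHomogeneous k) (hsq : Squarefree F)
    {d : ℕ} (hd : 1 ≤ d) {G₀ : MvPolynomial (Fin 3) ℂ} (hG : G₀.IsHomogeneous d)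
    {N : Set (Fin 3 → Fin 3 → ℂ)} (hN : N ∈ 𝓝 0) :
    ∃ θ ∈ N, IsSmoothCurve (zeroLocus (fam d G₀ θ)) d ∧
      Transverse (zeroLocus (fam d G₀ θ)) (range (hP.smoothMap t (regLocus F)).toFun) ∧
      Disjoint (zeroLocus (fam d G₀ θ)) (singLocus F) := by
  let μ : Measure (Fin 3 → Fin 3 → ℂ) := Measure.addHaar
  have hdense := Measure.dense_of_ae
    ((ae_singLocus_fam_eq_empty μ hd hG).and ((ae_transverse_fam μ hP t hF hd hG).and
      (ae_disjoint_zeroLocus_fam μ hd G₀ (countable_singLocus hF hsq))))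
  obtain ⟨θ, ⟨h1, h2, h3⟩, hθ⟩ := hdense.inter_nhds_nonempty hN
  exact ⟨θ, hθ, ⟨_, isHomogeneous_fam hd hG θ, h1, rfl⟩, h2, h3⟩

end CP2

end

theorem theorem1 (k : ℕ) (hk : 1 ≤ k) (F : MvPolynomial (Fin 3) ℂ) (hF : F.IsHomogeneous k)
    (hsq : Squarefree F) (a : ℕ → ℕ) (ha : ∀ d, 0 < a d) :
    ∃ K : Set (CP2.regLocus F), IsCompact K ∧
      ∀ 𝒰 ∈ 𝓝 (CP2.SmoothMap.incl (CP2.regLocus F)),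
        ∃ η ∈ 𝒰, η.IsSmoothEmbedding ∧ (∀ p ∉ K, η.toFun p = p) ∧
          Disjoint (range η.toFun) (CP2.singLocus F) ∧
          CP2.IsSymplectic (range η.toFun) ∧
          ∃ Z : ℕ → Set CP2,
            (∀ d, 1 ≤ d → CP2.IsSmoothCurve (Z d) d ∧
              CP2.Transverse (Z d) (range η.toFun) ∧ Disjoint (Z d) (CP2.singLocus F)) ∧
            {d | 1 ≤ d ∧
              (a d : ℕ∞) ≤ (Z d ∩ (range η.toFun ∪ CP2.singLocus F)).encard}.Infinite := by
  obtain ⟨q, i, j, c, hic, hji, hjc, hqi, hq0, hqc⟩ :=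
    CP2.exists_normalized_regular_point hF hk hsq
  obtain ⟨P, A, σ, U, x, hP, hA, hAreg, hPA, hU, hσ, hx, hxU⟩ :=
    CP2.exists_perturbation hF hic hji hjc hqi hq0 hqc
  -- The compact set comes from `A` alone and is fixed before `𝒰`; only `t` depends on `𝒰`.
  refine ⟨_, CP2.isCompact_regLocus_preimage hF hA hAreg, fun 𝒰 h𝒰 => ?_⟩
  obtain ⟨M, hM⟩ := hP.exists_lipschitzWith
  have hsmall : ∀ᶠ t : ℝ in 𝓝 0, |t| * M < 1 :=
    (continuous_abs.mul continuous_const).continuousAt.eventually_lt continuousAt_const (by simp)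
  obtain ⟨t, ⟨ht𝒰, htM, htsymp⟩, ht0⟩ :=
    ((((hP.tendsto_smoothMap (CP2.regLocus F)).eventually h𝒰).and
      (hsmall.and (hP.eventually_isSymplectic hF hM))).filter_mono
        nhdsWithin_le_nhds |>.and (eventually_mem_nhdsWithin (a := (0 : ℝ)) (s := {0}ᶜ))).exists
  -- Where `P` does not vanish, a multiple of the point lies in `A`, and there the gradient of `F`
  -- is nonzero.
  have hsing : ∀ p ∈ CP2.singLocus F, P p.rep = 0 := by
    intro p hp
    by_contra hne
    obtain ⟨s, hs, hsA⟩ := hPA _ hne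
    obtain ⟨hs0, l, hl⟩ := hAreg _ hsA
    rw [CP2.eval_smul_of_isHomogeneous hF.pderiv, hp.2 l, mul_zero] at hl
    exact hl rfl
  refine ⟨hP.smoothMap t _, ht𝒰, hP.isSmoothEmbedding_smoothMap hM htM _, ?_, ?_, htsymp htM, ?_⟩
  · intro p hp
    refine CP2.pertMap_eq_self t (by_contra fun hne => hp ?_)
    obtain ⟨s, hs, hsA⟩ := hPA _ hne
    refine ⟨s • p.1.rep, ⟨hsA, ?_⟩, by rw [CP2.proj_smul p.1.rep_nonzero hs, CP2.proj_rep]⟩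
    have : MvPolynomial.eval p.1.rep F = 0 := p.2.1
    rw [mem_ofPred_eq, CP2.eval_smul_of_isHomogeneous hF, this, mul_zero]
  -- A singular point is fixed by the injective self-map, so a regular point sent to it would
  -- coincide with it.
  · rw [disjoint_left]
    rintro _ ⟨p, rfl⟩ hp
    have h1 : CP2.pertMap P t (CP2.pertMap P t p) = CP2.pertMap P t p :=
      CP2.pertMap_eq_self t (hsing _ hp)
    have h2 : CP2.pertMap P t p = p := hP.injective_pertMap hM htM h1
    refine p.2.2 ?_
    rw [← h2]
    exact hp
  · set τ : ℂ → Fin 3 → ℂ := fun y => σ y + t • P (σ y) with hτ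
    have hσ0 : ∀ y ∈ U, σ y ≠ 0 := by
      intro y hy h0
      have h1 := ((hσ y hy).2.2 0).1
      simp [h0] at h1
    have hτU : ∀ y ∈ U, ContDiffAt ℝ ∞ τ y ∧
        CP2.proj (τ y) ∈ range (hP.smoothMap t (CP2.regLocus F)).toFun ∧ τ y i = 1 ∧ τ y j = y :=
      fun y hy => ⟨(hP.contDiffAt_pert t (hσ0 y hy)).comp y (hσ y hy).1,
        hP.proj_pert_mem_range t (hσ0 y hy) (hσ y hy).2.1, (hσ y hy).2.2 t⟩
    have hZ : ∀ d, ∃ Z : Set CP2, 1 ≤ d → (CP2.IsSmoothCurve Z d ∧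
        CP2.Transverse Z (range (hP.smoothMap t (CP2.regLocus F)).toFun) ∧
          Disjoint Z (CP2.singLocus F)) ∧
        (k ≤ d → (a d : ℕ∞) ≤ (Z ∩ range (hP.smoothMap t (CP2.regLocus F)).toFun).encard) := by
      intro d
      by_cases hd : 1 ≤ d
      swap
      · exact ⟨∅, fun h => absurd h hd⟩
      by_cases hkd : k ≤ d
      -- On the patch the coordinate `i` equals `1`, so this form restricts to `F` and has the same
      -- nondegenerate zeros.
      · have hG : (F * MvPolynomial.X i ^ (d - k)).IsHomogeneous d := by
          have := hF.mul (MvPolynomial.isHomogeneous_X_pow (R := ℂ) i (d - k))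
          rwa [Nat.add_sub_cancel' hkd] at this
        have heval : ∀ y ∈ U, MvPolynomial.eval (τ y) (F * MvPolynomial.X i ^ (d - k)) =
            MvPolynomial.eval (τ y) F := fun y hy => by
          rw [map_mul, map_pow, MvPolynomial.eval_X, (hτU y hy).2.2.1, one_pow, mul_one]
        obtain ⟨θ, hθ, h⟩ := CP2.exists_fam_mem hP t hF hsq hd hG
          (CP2.eventually_le_encard hd hG hU hτU hx (fun n => by
            obtain ⟨hn, h⟩ := hxU n
            refine ⟨hn, (heval _ hn).trans (h t ht0).1, ?_⟩
            rw [Filter.EventuallyEq.fderiv_eq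
              ((hU.eventually_mem hn).mono fun y hy => heval y hy)]
            exact (h t ht0).2) (a d))
        exact ⟨_, fun _ => ⟨h, fun _ => hθ⟩⟩
      -- In degrees below `k` no count is required; any generic member of the family based at `G₀ =
      -- 0` will do.
      · obtain ⟨θ, -, h⟩ := CP2.exists_fam_mem hP t hF hsq hd
          (MvPolynomial.isHomogeneous_zero (Fin 3) ℂ d) univ_mem
        exact ⟨_, fun _ => ⟨h, fun h => absurd h hkd⟩⟩
    choose Z hZ using hZ
    refine ⟨Z, fun d hd => (hZ d hd).1, (Set.Ici_infinite k).mono fun d hd => ?_⟩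
    have hd1 : 1 ≤ d := hk.trans hd
    exact ⟨hd1, ((hZ d hd1).2 hd).trans
      (encard_le_encard (inter_subset_inter_right _ subset_union_left))⟩
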